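/- **Setting.** Let $d_x,d_\phi,H,T\ge 1$ and $\sigma>0$, let $\mathcal U$ be a measurable space, let $\phi:\mathbb R^{d_x}\times\mathcal U\to\mathbb R^{d_\phi}$ be measurable with $\|\phi(x,u)\|_2\le B$ for all $x,u$, and let $A_\star\in\mathbb R^{d_x\times d_\phi}$. Consider episodes of length $H$ of the system $$x_{h+1}=A_\star\phi(x_h,u_h)+w_h,\qquad w_h\sim\mathcal N(0,\sigma^2 I)\text{ independent},\qquad x_1 \text{ fixed}.$$ *Task.* Let $\mathrm{cost}_h:\mathbb R^{d_x}\times\mathcal U\to[0,\infty)$ be measurable step costs and $\{\pi^\theta:\theta\in\mathbb R^{d_\theta}\}$ a class of measurable deterministic closed-loop controllers ($u_h$ is a function of $x_1,u_1,\dots,u_{h-1},x_h$). Let $\mathcal J(\pi;A)$ be the expected total cost of one episode when $\pi$ is played on the system with matrix $A$. Suppose there are $r>0$ and $L$ such that for all $A$ with $\|A-A_\star\|_{\mathrm F}\le r$: the total cost of $\pi^\theta$ on $A$ has second moment at most $L$ for every $\theta$; and $\theta_\star(A)\in\arg\min_\theta\mathcal J(\pi^\theta;A)$. Put $\pi_\star(A)=\pi^{\theta_\star(A)}$,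 suppose that $A\mapsto\mathcal J(\pi_\star(A);A_\star)$ is twice differentiable at $A_\star$, and let $\mathcal H(A_\star)=\nabla_A^2\,\mathcal J(\pi_\star(A);A_\star)|_{A=A_\star}$, a $d_xd_\phi\times d_xd_\phi$ matrix in the coordinates $\mathrm{vec}(A)$ (rows stacked). *Interaction.* The learner interacts with the system (with matrix $A_\star$) for $T$ episodes; its inputs $u_h^t$ may be randomized and may depend on everything observed before, in this and in earlier episodes. Let $$\Lambda_T=\sum_{t=1}^T\sum_{h=1}^H\phi(x_h^t,u_h^t)\phi(x_h^t,u_h^t)^\top,\quad \check\Lambda_T=I_{d_x}\otimes\Lambda_T,\quad \widehat A\in\arg\min_A\sum_{t=1}^T\sum_{h=1}^H\|x_{h+1}^t-A\phi(x_h^t,u_h^t)\|_2^2 ,$$ and write $\|v\|_M^2=v^\top Mv$. **Statement.** There is a universal constant $C>0$ such that, in every such setting and for every $\delta\in(0,1)$, the following hold. 1. (Any adaptive exploration.) With probability at least $1-\delta$, either $\Lambda_T$ is singular or $$\|\mathrm{vec}(A_\star-\widehat A)\|_{\mathcal H(A_\star)}^2\le C\Big(\log\tfrac1\delta+d_xd_\phi\log\big(2+\tfrac{THB^2}{\lambda_{\min}(\Lambda_T)}\big)\Big)\,\sigma^2\,\mathrm{tr}\big(\mathcal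 H(A_\star)\check\Lambda_T^{-1}\big).$$ 2. (Any adaptive exploration, on the event that the observed covariance is close to a deterministic matrix.) For every deterministic positive definite $\Gamma\in\mathbb R^{d_xd_\phi\times d_xd_\phi}$ and $\beta\in[0,1/4]$, with probability at least $1-\delta$, either $(1-\beta)\Gamma\preceq\check\Lambda_T\preceq(1+\beta)\Gamma$ fails or $$\|\mathrm{vec}(A_\star-\widehat A)\|_{\mathcal H(A_\star)}^2\le C\,(1+\beta^2d_xd_\phi)\,\log\tfrac{6d_xd_\phi}{\delta}\;\sigma^2\,\mathrm{tr}\big(\mathcal H(A_\star)\check\Lambda_T^{-1}\big).$$ 3. (Independent episodes, e.g. exploration policies fixed in advance.) If the trajectories of the $T$ episodes are independent, $\lambda_{\min}(\mathbb E[\Lambda_T])\ge\lambda T$ for some $\lambda>0$, and $T\ge C\,\frac{d_xd_\phi^3H^2B^4}{\lambda^2}\log\frac{6d_xd_\phi}{\delta}$, then with probability at least $1-\delta$ the matrix $\Lambda_T$ is positive definite and $$\|\mathrm{vec}(A_\star-\widehat A)\|_{\mathcal H(A_\star)}^2\le C\,\log\tfrac{6d_xd_\phi}{\delta}\;\sigma^2\,\mathrm{tr}\big(\mathcal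 H(A_\star)\check\Lambda_T^{-1}\big).$$ -/

import Mathlib

open MeasureTheory ProbabilityTheory
open scoped Matrix Kronecker Topology

/-- States and feature vectors: `ℝⁿ` with the Euclidean norm. -/
abbrev Vec (n : ℕ) : Type := EuclideanSpace ℝ (Fin n)

/-- A system `x_{h+1} = A φ(x_h, u_h) + w_h` with `w_h ∼ N(0, σ² I)` and fixed initial state `x₁`,
up to the unknown matrix `A`. -/
structure NonlinearSystem (dx dφ : ℕ) (U : Type*) [MeasurableSpace U] where
  φ : Vec dx → U → Vec dφ
  measurable_φ : Measurable (Function.uncurry φ)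
  x₁ : Vec dx
  σ : ℝ
  σ_pos : 0 < σ

namespace NonlinearSystem

variable {dx dφ : ℕ} {U : Type*} [MeasurableSpace U]

/-- The noise-free part `A φ(x, u)` of the dynamics. -/
def drift (S : NonlinearSystem dx dφ U) (A : Matrix (Fin dx) (Fin dφ) ℝ)
    (x : Vec dx) (u : U) : Vec dx :=
  WithLp.toLp 2 (A *ᵥ (S.φ x u).ofLp)

/-- The Gaussian law `N(0, σ² I)` on the state space. -/
noncomputable def noiseLaw (S : NonlinearSystem dx dφ U) : Measure (Vec dx) :=
  (stdGaussian (Vec dx)).map (fun z => S.σ • z)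

end NonlinearSystem

/-! ### Controllers and their expected cost -/

/-- What has been observed when the input of step `h` is chosen (steps are counted from `0`):
the states of steps `0, …, h` and the inputs of steps `0, …, h - 1`. -/
abbrev History (dx : ℕ) (U : Type*) (h : ℕ) : Type _ := (Fin (h + 1) → Vec dx) × (Fin h → U)

/-- A deterministic closed-loop controller. -/
abbrev Controller (dx : ℕ) (U : Type*) : Type _ := (h : ℕ) → History dx U h → U

namespace NonlinearSystem

variable {dx dφ : ℕ} {U : Type*} [MeasurableSpace U]

/-- The trajectory of the system with matrix `A` under the controller `π`, driven by the noise
sequence `w`. -/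
def rollout (S : NonlinearSystem dx dφ U) (A : Matrix (Fin dx) (Fin dφ) ℝ)
    (π : Controller dx U) (w : ℕ → Vec dx) : (h : ℕ) → History dx U h
  | 0 => (fun _ => S.x₁, Fin.elim0)
  | h + 1 =>
    let τ := S.rollout A π w h
    let u := π h τ
    (Fin.snoc (α := fun _ => Vec dx) τ.1 (S.drift A (τ.1 (Fin.last h)) u + w h),
      Fin.snoc (α := fun _ => U) τ.2 u)

/-- The total cost `∑ₕ costₕ(xₕ, uₕ)` of an episode of length `H`. -/
def totalCost (S : NonlinearSystem dx dφ U) (H : ℕ) (cost : ℕ → Vec dx → U → ℝ)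
    (A : Matrix (Fin dx) (Fin dφ) ℝ) (π : Controller dx U) (w : ℕ → Vec dx) : ℝ :=
  ∑ h ∈ Finset.range H,
    cost h ((S.rollout A π w h).1 (Fin.last h)) (π h (S.rollout A π w h))

/-- The law of an i.i.d. noise sequence. -/
noncomputable def noiseSeqLaw (S : NonlinearSystem dx dφ U) : Measure (ℕ → Vec dx) :=
  Measure.infinitePi (fun _ : ℕ => S.noiseLaw)

/-- The expected cost `J(π; A)`. -/
noncomputable def expectedCost (S : NonlinearSystem dx dφ U) (H : ℕ)
    (cost : ℕ → Vec dx → U → ℝ) (A : Matrix (Fin dx) (Fin dφ) ℝ) (π : Controller dx U) : ℝ :=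
  ∫ w, S.totalCost H cost A π w ∂S.noiseSeqLaw

end NonlinearSystem

/-! ### Vectorization, Mahalanobis norm, model-task Hessian -/

/-- Vectorization of a matrix, rows stacked; its Euclidean norm is the Frobenius norm. -/
def vecMat {dx dφ : ℕ} (A : Matrix (Fin dx) (Fin dφ) ℝ) : EuclideanSpace ℝ (Fin dx × Fin dφ) :=
  WithLp.toLp 2 (fun p => A p.1 p.2)

/-- The inverse of `vecMat`. -/
def unvecMat {dx dφ : ℕ} (a : EuclideanSpace ℝ (Fin dx × Fin dφ)) :
    Matrix (Fin dx) (Fin dφ) ℝ :=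
  Matrix.of fun i j => a (i, j)

/-- `‖v‖_M = √(vᵀ M v)`. -/
noncomputable def mahalanobisNorm {ι : Type*} [Fintype ι] (M : Matrix ι ι ℝ)
    (v : EuclideanSpace ℝ ι) : ℝ :=
  Real.sqrt (v.ofLp ⬝ᵥ (M *ᵥ v.ofLp))

/-- The Hessian matrix of `f` at `a`. -/
noncomputable def hessianMatrix {ι : Type*} [Fintype ι] [DecidableEq ι]
    (f : EuclideanSpace ℝ ι → ℝ) (a : EuclideanSpace ℝ ι) : Matrix ι ι ℝ :=
  Matrix.of fun p q =>
    fderiv ℝ (fderiv ℝ f) a (EuclideanSpace.single p 1) (EuclideanSpace.single q 1)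

/-- `f` is twice differentiable at `a`. -/
def TwiceDifferentiableAt {E : Type*} [NormedAddCommGroup E] [NormedSpace ℝ E]
    (f : E → ℝ) (a : E) : Prop :=
  (∀ᶠ b in 𝓝 a, DifferentiableAt ℝ f b) ∧ DifferentiableAt ℝ (fderiv ℝ f) a

/-- A control task: step costs and a parametric class of controllers. -/
structure ControlTask (dx dθ : ℕ) (U : Type*) [MeasurableSpace U] where
  cost : ℕ → Vec dx → U → ℝ
  cost_nonneg : ∀ h x u, 0 ≤ cost h x u
  measurable_cost : ∀ h, Measurable (Function.uncurry (cost h))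
  π : Vec dθ → Controller dx U
  measurable_π : ∀ θ h, Measurable (π θ h)

namespace ControlTask

variable {dx dφ dθ : ℕ} {U : Type*} [MeasurableSpace U]

/-- On a Frobenius ball around `Astar`, the total cost of every controller of the class has second
moment at most `L`. -/
def BoundedCost (K : ControlTask dx dθ U) (S : NonlinearSystem dx dφ U) (H : ℕ)
    (Astar : Matrix (Fin dx) (Fin dφ) ℝ) (r L : ℝ) : Prop :=
  ∀ A, ‖vecMat (A - Astar)‖ ≤ r → ∀ θ,
    ∫⁻ w, ENNReal.ofReal (S.totalCost H K.cost A (K.π θ) w) ^ 2 ∂S.noiseSeqLaw ≤ ENNReal.ofReal L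

/-- Certainty equivalence: for all `A` in a Frobenius ball around `Astar`, `θstar A` is a global
minimizer of `θ ↦ J(π^θ; A)`. -/
def IsOptimalNear (K : ControlTask dx dθ U) (S : NonlinearSystem dx dφ U) (H : ℕ)
    (Astar : Matrix (Fin dx) (Fin dφ) ℝ) (r : ℝ)
    (θstar : Matrix (Fin dx) (Fin dφ) ℝ → Vec dθ) : Prop :=
  ∀ A, ‖vecMat (A - Astar)‖ ≤ r → ∀ θ,
    S.expectedCost H K.cost A (K.π (θstar A)) ≤ S.expectedCost H K.cost A (K.π θ)

/-- `vec A ↦ J(π^{θstar(A)}; Astar)`: the cost on the true system of the controller designed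
for `A`. -/
noncomputable def ceCost (K : ControlTask dx dθ U) (S : NonlinearSystem dx dφ U) (H : ℕ)
    (Astar : Matrix (Fin dx) (Fin dφ) ℝ) (θstar : Matrix (Fin dx) (Fin dφ) ℝ → Vec dθ)
    (a : EuclideanSpace ℝ (Fin dx × Fin dφ)) : ℝ :=
  S.expectedCost H K.cost Astar (K.π (θstar (unvecMat a)))

/-- The model-task Hessian `∇²_A J(π^{θstar(A)}; Astar)` at `A = Astar`. -/
noncomputable def modelTaskHessian (K : ControlTask dx dθ U) (S : NonlinearSystem dx dφ U) (H : ℕ)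
    (Astar : Matrix (Fin dx) (Fin dφ) ℝ) (θstar : Matrix (Fin dx) (Fin dφ) ℝ → Vec dθ) :
    Matrix (Fin dx × Fin dφ) (Fin dx × Fin dφ) ℝ :=
  hessianMatrix (K.ceCost S H Astar θstar) (vecMat Astar)

end ControlTask

/-! ### Interaction and least squares -/

/-- `T` episodes of length `H` of interaction with the system with matrix `A`. The σ-algebra
`ℱ (t, h)` is the information available when the input of step `h` of episode `t` is chosen:
it contains all earlier noises (hence all states so far) and possibly further randomization of the
learner, and the noise of step `h` of episode `t` is independent of it. Inputs may thus be
randomized and depend on everything observed so far, in this and in all previous episodes. -/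
structure Interaction {dx dφ : ℕ} {U : Type*} [MeasurableSpace U] (S : NonlinearSystem dx dφ U)
    (A : Matrix (Fin dx) (Fin dφ) ℝ) (T H : ℕ)
    {Ω : Type*} [mΩ : MeasurableSpace Ω] (P : Measure Ω) where
  x : Fin T → Fin (H + 1) → Ω → Vec dx
  u : Fin T → Fin H → Ω → U
  w : Fin T → Fin H → Ω → Vec dx
  ℱ : Filtration (Fin T ×ₗ Fin H) mΩ
  measurable_u : ∀ t h, Measurable[ℱ (toLex (t, h))] (u t h)
  measurable_w : ∀ t h, Measurable (w t h)
  measurable_w_past : ∀ t h s k, toLex (t, h) < toLex (s, k) →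
    Measurable[ℱ (toLex (s, k))] (w t h)
  law_w : ∀ t h, HasLaw (w t h) S.noiseLaw P
  indep_w : ∀ t h, Indep (MeasurableSpace.comap (w t h) inferInstance) (ℱ (toLex (t, h))) P
  initial : ∀ t ω, x t 0 ω = S.x₁
  dynamics : ∀ t h ω,
    x t h.succ ω = S.drift A (x t h.castSucc ω) (u t h ω) + w t h ω

namespace Interaction

variable {dx dφ : ℕ} {U : Type*} [MeasurableSpace U] {S : NonlinearSystem dx dφ U}
  {A : Matrix (Fin dx) (Fin dφ) ℝ} {T H : ℕ} {Ω : Type*} [MeasurableSpace Ω] {P : Measure Ω}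

/-- The observed feature `φ(x_h^t, u_h^t)`. -/
def feature (I : Interaction S A T H P) (t : Fin T) (h : Fin H) (ω : Ω) : Vec dφ :=
  S.φ (I.x t h.castSucc ω) (I.u t h ω)

/-- `Λ_T = ∑ₜ ∑ₕ φ(x_h^t, u_h^t) φ(x_h^t, u_h^t)ᵀ`. -/
def covariance (I : Interaction S A T H P) (ω : Ω) : Matrix (Fin dφ) (Fin dφ) ℝ :=
  ∑ t, ∑ h, Matrix.vecMulVec (I.feature t h ω).ofLp (I.feature t h ω).ofLp

/-- `I ⊗ Λ_T`. -/
def blockCovariance (I : Interaction S A T H P) (ω : Ω) :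
    Matrix (Fin dx × Fin dφ) (Fin dx × Fin dφ) ℝ :=
  (1 : Matrix (Fin dx) (Fin dx) ℝ) ⊗ₖ I.covariance ω

/-- The entrywise expectation of `Λ_T`. -/
noncomputable def meanCovariance (I : Interaction S A T H P) : Matrix (Fin dφ) (Fin dφ) ℝ :=
  Matrix.of fun i j => ∫ ω, I.covariance ω i j ∂P

/-- The least-squares loss `∑ₜ ∑ₕ ‖x_{h+1}^t - B φ(x_h^t, u_h^t)‖²`. -/
noncomputable def lsLoss (I : Interaction S A T H P) (ω : Ω)
    (B : Matrix (Fin dx) (Fin dφ) ℝ) : ℝ :=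
  ∑ t, ∑ h, ‖I.x t h.succ ω - S.drift B (I.x t h.castSucc ω) (I.u t h ω)‖ ^ 2

/-- `Ahat` minimizes the least-squares loss, for every outcome. -/
def IsLeastSquares (I : Interaction S A T H P) (Ahat : Ω → Matrix (Fin dx) (Fin dφ) ℝ) : Prop :=
  ∀ ω B, I.lsLoss ω (Ahat ω) ≤ I.lsLoss ω B

/-- The state-input trajectory of episode `t`. -/
def episode (I : Interaction S A T H P) (t : Fin T) (ω : Ω) :
    (Fin (H + 1) → Vec dx) × (Fin H → U) :=
  (fun h => I.x t h ω, fun h => I.u t h ω)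

end Interaction

/-!
The least-squares error `e = vec(Ahat - A⋆)` solves the normal equations `Λ e = g`, where `Λ` is the
block covariance `1 ⊗ Λ_T` and `g = ∑ w ⊗ φ` is the score. Since the controller designed for `A⋆`
is optimal for `A⋆`, the cost has a minimum there and the model-task Hessian `M` is positive
semidefinite (`ControlTask.posSemidef_modelTaskHessian`). All probabilistic input about `e` comes
from one fact: for every direction `a`, the exponential `exp (a · g - σ² (a · Λ a) / 2)` has mean at
most one (`Interaction.lintegral_exp_score_le_one`), because the noise is Gaussian and independent
of the past.

*Adaptive exploration.* By Cauchy–Schwarz, `e · M e ≤ tr (M Λ⁻¹) (e · Λ e)`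
(`Matrix.PosSemidef.dotProduct_mulVec_le_trace_mul`). The self-normalized error `e · Λ e` is bounded
by the method of mixtures, averaging the exponential over a Gaussian prior on `a`
(`measure_log_le_selfNormalized`); a union bound over dyadic scales of the prior makes it adapt to
the random smallest eigenvalue of `Λ` (`measure_selfNormalized_stitched`).

*Covariance close to a deterministic `Γ`.* In a `Γ`-orthonormal basis diagonalizing `M`, the
exponential bound for the `2 dx dφ` signed basis directions controls every coordinate of `g`. As `Λ`
is within `1 ± β` of the identity in these coordinates, those of `e` differ from those of `g` by at
most a multiple of `β |g|`, which costs only the factor `1 + β² dx dφ`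
(`dotProduct_mulVec_le_trace_of_near`, `measure_weighted_error_near`).

*Independent episodes.* Hoeffding's inequality for the entries of `Λ_T` puts it within `1 ± β` of
its mean for `β = 1 / (4 √(dx dφ))` (`Interaction.measure_not_near_meanCovariance`), and the
previous bound applies with `Γ = 1 ⊗ 𝔼 Λ_T`.
-/

/-! ### Second-order necessary condition -/

theorem TwiceDifferentiableAt.isSymm_hessianMatrix {ι : Type*} [Fintype ι] [DecidableEq ι]
    {f : EuclideanSpace ℝ ι → ℝ} {a : EuclideanSpace ℝ ι} (hf : TwiceDifferentiableAt f a) :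
    (hessianMatrix f a).IsSymm := by
  ext p q
  have h := second_derivative_symmetric_of_eventually_of_real
    (f := f) (f' := fderiv ℝ f) (x := a) (f'' := fderiv ℝ (fderiv ℝ f) a)
    (hf.1.mono fun y hy => hy.hasFDerivAt) hf.2.hasFDerivAt
  simpa [hessianMatrix] using h _ _

theorem dotProduct_hessianMatrix_mulVec {ι : Type*} [Fintype ι] [DecidableEq ι]
    (f : EuclideanSpace ℝ ι → ℝ) (a v : EuclideanSpace ℝ ι) :
    v.ofLp ⬝ᵥ (hessianMatrix f a *ᵥ v.ofLp) = fderiv ℝ (fderiv ℝ f) a v v := by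
  have hv : v = ∑ p, v p • EuclideanSpace.single p (1 : ℝ) := by
    simpa using ((EuclideanSpace.basisFun ι ℝ).sum_repr v).symm
  conv_rhs => rw [hv]
  simp only [map_sum, map_smul, sum_apply, smul_apply,
    dotProduct, Matrix.mulVec, hessianMatrix, Matrix.of_apply, smul_eq_mul, Finset.mul_sum]
  rw [Finset.sum_comm]
  refine Finset.sum_congr rfl fun p _ => Finset.sum_congr rfl fun q _ => ?_
  ring

/-- A negative second derivative along a line through a local minimum would make it a strict local
maximum along that line. -/
theorem TwiceDifferentiableAt.fderiv_fderiv_nonneg_of_isLocalMin {E : Type*}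
    [NormedAddCommGroup E] [NormedSpace ℝ E] {f : E → ℝ} {a : E}
    (hf : TwiceDifferentiableAt f a) (hmin : IsLocalMin f a) (v : E) :
    0 ≤ fderiv ℝ (fderiv ℝ f) a v v := by
  set γ : ℝ → E := fun t => a + t • v with hγ
  have hγd : ∀ t, HasDerivAt γ v t := fun t => by
    simpa only [hγ, id_eq, one_smul] using ((hasDerivAt_id t).smul_const v).const_add a
  have hγ0 : γ 0 = a := by simp [hγ]
  have hγc : Filter.Tendsto γ (𝓝 0) (𝓝 a) := by
    simpa [hγ0] using (hγd 0).continuousAt.tendsto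
  have hd : ∀ᶠ t in 𝓝 (0 : ℝ), HasDerivAt (f ∘ γ) (fderiv ℝ f (γ t) v) t :=
    (hγc.eventually hf.1).mono fun t ht => ht.hasFDerivAt.comp_hasDerivAt t (hγd t)
  have hd' : deriv (f ∘ γ) =ᶠ[𝓝 0] fun t => fderiv ℝ f (γ t) v := hd.mono fun t ht => ht.deriv
  have hdd : HasDerivAt (fun t => fderiv ℝ f (γ t) v) (fderiv ℝ (fderiv ℝ f) a v v) 0 := by
    have h2 := hf.2.hasFDerivAt
    rw [← hγ0] at h2
    have := h2.comp_hasDerivAt (0 : ℝ) (hγd 0)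
    rw [hγ0] at this
    exact (this.clm_apply (hasDerivAt_const (0 : ℝ) v)).congr_deriv (by simp)
  have hderiv2 : deriv (deriv (f ∘ γ)) 0 = fderiv ℝ (fderiv ℝ f) a v v := by
    rw [hd'.deriv_eq, hdd.deriv]
  have hmin' : IsLocalMin (f ∘ γ) 0 := by
    have := hγc.eventually hmin
    filter_upwards [this] with t ht
    simpa [hγ0] using ht
  by_contra hneg
  push Not at hneg
  have hmax : IsLocalMax (f ∘ γ) 0 :=
    isLocalMax_of_deriv_deriv_neg (by rw [hderiv2]; exact hneg) hmin'.deriv_eq_zero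
      hd.self_of_nhds.continuousAt
  -- a local minimum that is also a local maximum is locally constant
  have hconst : f ∘ γ =ᶠ[𝓝 0] fun _ => (f ∘ γ) 0 := by
    filter_upwards [hmin', hmax] with t h1 h2 using le_antisymm h2 h1
  have h0 : deriv (deriv (f ∘ γ)) 0 = 0 := by
    rw [hconst.deriv.deriv_eq]; simp
  linarith [hderiv2]

theorem TwiceDifferentiableAt.posSemidef_hessianMatrix {ι : Type*} [Fintype ι] [DecidableEq ι]
    {f : EuclideanSpace ℝ ι → ℝ} {a : EuclideanSpace ℝ ι} (hf : TwiceDifferentiableAt f a)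
    (hmin : IsLocalMin f a) : (hessianMatrix f a).PosSemidef := by
  refine Matrix.PosSemidef.of_dotProduct_mulVec_nonneg ?_ fun v => ?_
  · simpa [Matrix.IsHermitian, Matrix.IsSymm] using hf.isSymm_hessianMatrix
  · have := hf.fderiv_fderiv_nonneg_of_isLocalMin hmin (WithLp.toLp 2 v)
    rw [← dotProduct_hessianMatrix_mulVec] at this
    simpa using this

/-- The controller designed for the true matrix is optimal for it, so `ceCost` has a minimum
there. -/
theorem ControlTask.posSemidef_modelTaskHessian {dx dφ dθ H : ℕ} {U : Type*} [MeasurableSpace U]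
    (K : ControlTask dx dθ U) (S : NonlinearSystem dx dφ U) (Astar : Matrix (Fin dx) (Fin dφ) ℝ)
    {r : ℝ} (hr : 0 < r) (θstar : Matrix (Fin dx) (Fin dφ) ℝ → Vec dθ)
    (hopt : K.IsOptimalNear S H Astar r θstar)
    (hd : TwiceDifferentiableAt (K.ceCost S H Astar θstar) (vecMat Astar)) :
    (K.modelTaskHessian S H Astar θstar).PosSemidef := by
  refine hd.posSemidef_hessianMatrix (Filter.Eventually.of_forall fun a => ?_)
  have hA : unvecMat (vecMat Astar) = Astar := rfl
  simp only [ControlTask.ceCost, hA]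
  refine hopt Astar ?_ _
  have h0 : vecMat (Astar - Astar) = 0 := by ext p; simp [vecMat]
  rw [h0, norm_zero]
  exact hr.le

/-! ### Weighted quadratic forms -/

theorem Matrix.PosSemidef.mul_dotProduct_mulVec_sq_le {ι : Type*} [Fintype ι] {M : Matrix ι ι ℝ}
    (hM : M.PosSemidef) (x y : ι → ℝ) :
    (x ⬝ᵥ M *ᵥ y) ^ 2 ≤ (x ⬝ᵥ M *ᵥ x) * (y ⬝ᵥ M *ᵥ y) := by
  have hsym : y ⬝ᵥ M *ᵥ x = x ⬝ᵥ M *ᵥ y := by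
    have hT : Mᵀ = M := by simpa using hM.isHermitian.eq
    rw [Matrix.dotProduct_mulVec, ← Matrix.mulVec_transpose, hT, dotProduct_comm]
  have h : ∀ t : ℝ, 0 ≤ (y ⬝ᵥ M *ᵥ y) * (t * t) + 2 * (x ⬝ᵥ M *ᵥ y) * t + x ⬝ᵥ M *ᵥ x := by
    intro t
    have := hM.dotProduct_mulVec_nonneg (x + t • y)
    simp only [star_trivial, Matrix.mulVec_add, Matrix.mulVec_smul, add_dotProduct, dotProduct_add,
      smul_dotProduct, dotProduct_smul, smul_eq_mul, hsym] at this
    linarith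
  have := discrim_le_zero h
  rw [discrim] at this
  nlinarith

/-- Writing `M = Gᵀ G`, this is the Cauchy–Schwarz inequality `(g · v)² ≤ (g · Λ⁻¹ g) (v · Λ v)`
summed over the rows `g` of `G`. -/
theorem Matrix.PosSemidef.dotProduct_mulVec_le_trace_mul {ι : Type*} [Fintype ι] [DecidableEq ι]
    {M Λ : Matrix ι ι ℝ} (hM : M.PosSemidef) (hΛ : Λ.PosDef) (v : ι → ℝ) :
    v ⬝ᵥ M *ᵥ v ≤ (M * Λ⁻¹).trace * (v ⬝ᵥ Λ *ᵥ v) := by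
  obtain ⟨G, rfl⟩ : ∃ G : Matrix ι ι ℝ, M = Gᵀ * G := by
    open scoped MatrixOrder in
    obtain ⟨G, hG⟩ := CStarAlgebra.nonneg_iff_eq_star_mul_self.mp hM.nonneg
    exact ⟨G, by simpa [Matrix.star_eq_conjTranspose] using hG⟩
  have hdet : IsUnit Λ.det := (Matrix.isUnit_iff_isUnit_det _).mp hΛ.isUnit
  have hrow : ∀ k, ((G *ᵥ v) k) ^ 2 ≤ (G k ⬝ᵥ Λ⁻¹ *ᵥ G k) * (v ⬝ᵥ Λ *ᵥ v) := by
    intro k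
    have h := hΛ.inv.posSemidef.mul_dotProduct_mulVec_sq_le (G k) (Λ *ᵥ v)
    have h1 : Λ⁻¹ *ᵥ (Λ *ᵥ v) = v := by
      rw [Matrix.mulVec_mulVec, Matrix.nonsing_inv_mul _ hdet, Matrix.one_mulVec]
    rw [h1, dotProduct_comm (Λ *ᵥ v)] at h
    exact h
  have htr : ((Gᵀ * G) * Λ⁻¹).trace = ∑ k, G k ⬝ᵥ Λ⁻¹ *ᵥ G k := by
    rw [Matrix.mul_assoc, Matrix.trace_mul_comm, Matrix.trace]
    refine Finset.sum_congr rfl fun k _ => ?_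
    rw [Matrix.diag_apply, Matrix.mul_apply, dotProduct_mulVec]
    simp only [dotProduct, Matrix.vecMul, Matrix.mul_apply, Matrix.transpose_apply]
  have hq : v ⬝ᵥ (Gᵀ * G) *ᵥ v = ∑ k, ((G *ᵥ v) k) ^ 2 := by
    rw [← Matrix.mulVec_mulVec, Matrix.dotProduct_mulVec, Matrix.vecMul_transpose]
    simp [dotProduct, sq]
  rw [hq, htr, Finset.sum_mul]
  exact Finset.sum_le_sum fun k _ => hrow k

/-- Simultaneous diagonalization of a positive definite and a symmetric form. -/
theorem Matrix.PosDef.exists_simultaneous_diagonalization {ι : Type*} [Fintype ι] [DecidableEq ι]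
    {Γ M : Matrix ι ι ℝ} (hΓ : Γ.PosDef) (hM : M.PosSemidef) :
    ∃ (Q : Matrix ι ι ℝ) (ev : ι → ℝ), IsUnit Q ∧ Qᵀ * Γ * Q = 1 ∧
      Qᵀ * M * Q = Matrix.diagonal ev ∧ ∀ i, 0 ≤ ev i := by
  obtain ⟨G, hG⟩ : ∃ G : Matrix ι ι ℝ, Γ = Gᵀ * G := by
    open scoped MatrixOrder in
    obtain ⟨G, hG⟩ := CStarAlgebra.nonneg_iff_eq_star_mul_self.mp hΓ.posSemidef.nonneg
    exact ⟨G, by simpa [Matrix.star_eq_conjTranspose] using hG⟩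
  have hGu : IsUnit G := by
    have h := hΓ.isUnit
    rw [hG, Matrix.isUnit_iff_isUnit_det, Matrix.det_mul] at h
    exact (Matrix.isUnit_iff_isUnit_det _).mpr (isUnit_of_mul_isUnit_right h)
  have hGd : IsUnit G.det := (Matrix.isUnit_iff_isUnit_det _).mp hGu
  have hN : ((G⁻¹)ᵀ * M * G⁻¹).PosSemidef := by
    simpa using hM.conjTranspose_mul_mul_same G⁻¹
  set N := (G⁻¹)ᵀ * M * G⁻¹ with hNdef
  set V : Matrix ι ι ℝ := (hN.isHermitian.eigenvectorUnitary : Matrix ι ι ℝ) with hV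
  have hVV : Vᵀ * V = 1 := by
    have := (Matrix.mem_unitaryGroup_iff').mp hN.isHermitian.eigenvectorUnitary.2
    simpa [Matrix.star_eq_conjTranspose] using this
  have hVV' : V * Vᵀ = 1 := by
    have := (Matrix.mem_unitaryGroup_iff).mp hN.isHermitian.eigenvectorUnitary.2
    simpa [Matrix.star_eq_conjTranspose] using this
  refine ⟨G⁻¹ * V, hN.isHermitian.eigenvalues, ?_, ?_, ?_, hN.eigenvalues_nonneg⟩
  · refine IsUnit.mul ?_ ?_
    · exact (Matrix.isUnit_nonsing_inv_iff).mpr hGu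
    · exact IsUnit.of_mul_eq_one _ hVV'
  · rw [hG, Matrix.transpose_mul]
    have h1 : (G⁻¹)ᵀ * Gᵀ = 1 := by
      rw [← Matrix.transpose_mul, Matrix.mul_nonsing_inv _ hGd, Matrix.transpose_one]
    have h2 : G * G⁻¹ = 1 := Matrix.mul_nonsing_inv _ hGd
    calc Vᵀ * (G⁻¹)ᵀ * (Gᵀ * G) * (G⁻¹ * V) = Vᵀ * ((G⁻¹)ᵀ * Gᵀ) * (G * G⁻¹) * V := by
          simp only [Matrix.mul_assoc]
      _ = 1 := by rw [h1, h2, Matrix.mul_one, Matrix.mul_one, hVV]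
  · rw [Matrix.transpose_mul]
    have hs : N = V * Matrix.diagonal hN.isHermitian.eigenvalues * Vᵀ := by
      have := hN.isHermitian.spectral_theorem
      simpa [Unitary.conjStarAlgAut_apply, Matrix.star_eq_conjTranspose, Function.comp_def]
        using this
    calc Vᵀ * (G⁻¹)ᵀ * M * (G⁻¹ * V) = Vᵀ * N * V := by
          simp only [hNdef, Matrix.mul_assoc]
      _ = (Vᵀ * V) * Matrix.diagonal hN.isHermitian.eigenvalues * (Vᵀ * V) := by
          conv_lhs => rw [hs]
          simp only [Matrix.mul_assoc]
      _ = _ := by rw [hVV, Matrix.one_mul, Matrix.mul_one]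

/-! ### Errors of a linear equation with a nearly diagonal matrix -/

theorem dotProduct_self_eq_sum_sq {ι : Type*} [Fintype ι] (z : ι → ℝ) :
    z ⬝ᵥ z = ∑ i, z i ^ 2 := by
  simp [dotProduct, sq]

/-- If `(1 - β) I ⪯ X ⪯ (1 + β) I`, each coordinate of `X z` differs from that of `z` by at most
`β |z|`. The proof polarizes the form `X - I` at `z` and `± |z| eᵢ`. -/
theorem sq_mulVec_sub_le_of_near_one {ι : Type*} [Fintype ι] [DecidableEq ι]
    {X : Matrix ι ι ℝ} {β : ℝ} (h1 : (X - (1 - β) • 1).PosSemidef)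
    (h2 : ((1 + β) • 1 - X).PosSemidef) (z : ι → ℝ) (i : ι) :
    ((X *ᵥ z) i - z i) ^ 2 ≤ β ^ 2 * (z ⬝ᵥ z) := by
  have hsymm : Xᵀ = X := by
    have := h1.isHermitian.eq
    simpa [Matrix.conjTranspose_sub] using this
  have hz0 : 0 ≤ z ⬝ᵥ z := by rw [dotProduct_self_eq_sum_sq]; positivity
  set r := Real.sqrt (z ⬝ᵥ z) with hr
  have hr2 : r * r = z ⬝ᵥ z := Real.mul_self_sqrt hz0
  have hlow : ∀ v : ι → ℝ, (1 - β) * (v ⬝ᵥ v) ≤ v ⬝ᵥ X *ᵥ v := fun v => by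
    have := h1.dotProduct_mulVec_nonneg v
    simp only [star_trivial, Matrix.sub_mulVec, Matrix.smul_mulVec, Matrix.one_mulVec,
      dotProduct_sub, dotProduct_smul, smul_eq_mul] at this
    linarith
  have hup : ∀ v : ι → ℝ, v ⬝ᵥ X *ᵥ v ≤ (1 + β) * (v ⬝ᵥ v) := fun v => by
    have := h2.dotProduct_mulVec_nonneg v
    simp only [star_trivial, Matrix.sub_mulVec, Matrix.smul_mulVec, Matrix.one_mulVec,
      dotProduct_sub, dotProduct_smul, smul_eq_mul] at this
    linarith
  set b : ι → ℝ := Pi.single i 1 with hb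
  have hbz : b ⬝ᵥ z = z i := by simp [hb]
  have hzb : z ⬝ᵥ b = z i := by simp [hb]
  have hbb : b ⬝ᵥ b = 1 := by simp [hb]
  have hbX : b ⬝ᵥ X *ᵥ z = (X *ᵥ z) i := by simp [hb]
  have hXb : z ⬝ᵥ X *ᵥ b = (X *ᵥ z) i := by
    rw [Matrix.dotProduct_mulVec, ← Matrix.mulVec_transpose, hsymm, dotProduct_comm, hbX]
  -- the forms of `X` and of the identity at `z + t b`, to be used for `t = ± |z|`
  have key : ∀ t : ℝ, (z + t • b) ⬝ᵥ X *ᵥ (z + t • b) =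
      z ⬝ᵥ X *ᵥ z + 2 * t * (X *ᵥ z) i + t * t * (b ⬝ᵥ X *ᵥ b) := fun t => by
    simp only [Matrix.mulVec_add, Matrix.mulVec_smul, add_dotProduct, dotProduct_add,
      smul_dotProduct, dotProduct_smul, smul_eq_mul, hbX, hXb]
    ring
  have key' : ∀ t : ℝ, (z + t • b) ⬝ᵥ (z + t • b) = z ⬝ᵥ z + 2 * t * z i + t * t := fun t => by
    simp only [add_dotProduct, dotProduct_add, smul_dotProduct, dotProduct_smul, smul_eq_mul,
      hbz, hzb, hbb]
    ring
  have a1 := hlow (z + r • b)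
  have a2 := hup (z + r • b)
  have a3 := hlow (z + (-r) • b)
  have a4 := hup (z + (-r) • b)
  rw [key, key', ← hr2] at a1 a2 a3 a4
  rcases eq_or_ne r 0 with h0 | h0
  · have hz : z = 0 := by
      rw [h0, zero_mul] at hr2
      exact dotProduct_self_eq_zero.mp hr2.symm
    simp [hz]
  · have hrp : 0 < r := lt_of_le_of_ne (Real.sqrt_nonneg _) (Ne.symm h0)
    have hu : (X *ᵥ z) i - z i ≤ β * r := by
      refine le_of_mul_le_mul_left ?_ hrp
      nlinarith
    have hl : -(β * r) ≤ (X *ᵥ z) i - z i := by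
      refine le_of_mul_le_mul_left ?_ hrp
      nlinarith
    calc ((X *ᵥ z) i - z i) ^ 2 ≤ (β * r) ^ 2 := sq_le_sq' hl hu
      _ = β ^ 2 * (z ⬝ᵥ z) := by rw [← hr2]; ring

/-- Cauchy–Schwarz for `X⁻¹`: `1 = (eᵢ · X⁻¹ X eᵢ)² ≤ (X⁻¹)ᵢᵢ Xᵢᵢ`. -/
theorem Matrix.PosDef.one_le_inv_diag_mul_diag {ι : Type*} [Fintype ι] [DecidableEq ι]
    {X : Matrix ι ι ℝ} (hX : X.PosDef) (i : ι) : 1 ≤ X⁻¹ i i * X i i := by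
  have hdet : IsUnit X.det := (Matrix.isUnit_iff_isUnit_det _).mp hX.isUnit
  have h := hX.inv.posSemidef.mul_dotProduct_mulVec_sq_le (Pi.single i 1) (X *ᵥ Pi.single i 1)
  have h1 : X⁻¹ *ᵥ (X *ᵥ Pi.single i 1) = Pi.single i 1 := by
    rw [Matrix.mulVec_mulVec, Matrix.nonsing_inv_mul _ hdet, Matrix.one_mulVec]
  rw [h1] at h
  simpa using h

theorem sum_mul_sq_le_of_near_one {ι : Type*} [Fintype ι] [DecidableEq ι]
    {X : Matrix ι ι ℝ} {β : ℝ} (hβ : β ≤ 1 / 4)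
    (h1 : (X - (1 - β) • 1).PosSemidef) (h2 : ((1 + β) • 1 - X).PosSemidef)
    {ev z : ι → ℝ} (hev : ∀ i, 0 ≤ ev i) {Y : ℝ} (hY : ∀ i, (X *ᵥ z) i ^ 2 ≤ Y) :
    ∑ i, ev i * z i ^ 2 ≤
      5 * (1 + β ^ 2 * Fintype.card ι) * Y * ∑ i, ev i * X⁻¹ i i := by
  have hX : X.PosDef := by
    have h : ((1 - β) • (1 : Matrix ι ι ℝ)).PosDef := Matrix.PosDef.one.smul (by linarith)
    simpa using h.add_posSemidef h1
  have hzz0 : 0 ≤ z ⬝ᵥ z := by rw [dotProduct_self_eq_sum_sq]; positivity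
  set y := X *ᵥ z with hy
  have hyy : y ⬝ᵥ y ≤ Fintype.card ι * Y := by
    rw [dotProduct_self_eq_sum_sq]
    calc ∑ i, y i ^ 2 ≤ ∑ _i : ι, Y := Finset.sum_le_sum fun i _ => hY i
      _ = Fintype.card ι * Y := by simp
  -- `(1 - β) |z|² ≤ z · X z = z · y` and `0 ≤ |y - (1 - β) z|²`
  have hzz : (9 / 16) * (z ⬝ᵥ z) ≤ y ⬝ᵥ y := by
    have h := h1.dotProduct_mulVec_nonneg z
    simp only [star_trivial, Matrix.sub_mulVec, Matrix.smul_mulVec, Matrix.one_mulVec,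
      dotProduct_sub, dotProduct_smul, smul_eq_mul, ← hy] at h
    have h' : 0 ≤ (y - (1 - β) • z) ⬝ᵥ (y - (1 - β) • z) := by
      rw [dotProduct_self_eq_sum_sq]; positivity
    simp only [sub_dotProduct, dotProduct_sub, smul_dotProduct, dotProduct_smul, smul_eq_mul,
      dotProduct_comm y z] at h'
    have h9 : (9 / 16 : ℝ) ≤ (1 - β) ^ 2 := by nlinarith
    have : (1 - β) * ((1 - β) * (z ⬝ᵥ z)) ≤ (1 - β) * (z ⬝ᵥ y) :=
      mul_le_mul_of_nonneg_left (by linarith) (by linarith)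
    nlinarith
  have hzi : ∀ i, z i ^ 2 ≤ (2 + 4 * (β ^ 2 * Fintype.card ι)) * Y := by
    intro i
    have hd := sq_mulVec_sub_le_of_near_one h1 h2 z i
    have hb : β ^ 2 * (z ⬝ᵥ z) ≤ β ^ 2 * (16 / 9 * (Fintype.card ι * Y)) :=
      mul_le_mul_of_nonneg_left (by linarith) (sq_nonneg β)
    have hYn : 0 ≤ Y := (sq_nonneg _).trans (hY i)
    have hbY : 0 ≤ β ^ 2 * Fintype.card ι * Y := by positivity
    rw [← hy] at hd
    nlinarith [sq_nonneg (2 * y i - z i), hY i]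
  have hinv : ∀ i, 4 / 5 ≤ X⁻¹ i i := by
    intro i
    have h := hX.one_le_inv_diag_mul_diag i
    have hXi : X i i ≤ 5 / 4 := by
      have := h2.diag_nonneg (i := i)
      simp at this
      linarith
    have hp := hX.inv.diag_pos (i := i)
    nlinarith
  rw [Finset.mul_sum]
  refine Finset.sum_le_sum fun i _ => ?_
  have hYn : 0 ≤ Y := (sq_nonneg _).trans (hY i)
  have hK : 0 ≤ (1 + β ^ 2 * Fintype.card ι) * Y := by positivity
  have hzi' : z i ^ 2 ≤ 5 * (1 + β ^ 2 * Fintype.card ι) * Y * X⁻¹ i i := by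
    have := mul_le_mul_of_nonneg_left (hinv i) hK
    have hbY : 0 ≤ β ^ 2 * Fintype.card ι * Y := by positivity
    nlinarith [hzi i]
  calc ev i * z i ^ 2 ≤ ev i * (5 * (1 + β ^ 2 * Fintype.card ι) * Y * X⁻¹ i i) :=
        mul_le_mul_of_nonneg_left hzi' (hev i)
    _ = _ := by ring

/-- The coordinates `z = Q⁻¹ e` reduce the claim to the case `Γ = 1`, `M` diagonal. -/
theorem dotProduct_mulVec_le_trace_of_near {ι : Type*} [Fintype ι] [DecidableEq ι]
    {M Γ Λ Q : Matrix ι ι ℝ} {ev : ι → ℝ} (hQ : IsUnit Q) (hQΓ : Qᵀ * Γ * Q = 1)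
    (hQM : Qᵀ * M * Q = Matrix.diagonal ev) (hev : ∀ i, 0 ≤ ev i)
    {β : ℝ} (hβ : β ≤ 1 / 4)
    (h1 : (Λ - (1 - β) • Γ).PosSemidef) (h2 : ((1 + β) • Γ - Λ).PosSemidef)
    (e : ι → ℝ) {Y : ℝ} (hY : ∀ i, (Qᵀ i ⬝ᵥ Λ *ᵥ e) ^ 2 ≤ Y) :
    e ⬝ᵥ M *ᵥ e ≤ 5 * (1 + β ^ 2 * Fintype.card ι) * Y * (M * Λ⁻¹).trace := by
  have hQd : IsUnit Q.det := (Matrix.isUnit_iff_isUnit_det _).mp hQ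
  have hQtd : IsUnit Qᵀ.det := by rwa [Matrix.det_transpose]
  obtain ⟨z, rfl⟩ : ∃ z, e = Q *ᵥ z := ⟨Q⁻¹ *ᵥ e, by
    rw [Matrix.mulVec_mulVec, Matrix.mul_nonsing_inv _ hQd, Matrix.one_mulVec]⟩
  set X := Qᵀ * Λ * Q with hX
  have hX1 : (X - (1 - β) • 1).PosSemidef := by
    have := h1.conjTranspose_mul_mul_same Q
    rw [Matrix.conjTranspose_eq_transpose_of_trivial, Matrix.mul_sub, Matrix.sub_mul,
      Matrix.mul_smul, Matrix.smul_mul, hQΓ] at this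
    exact this
  have hX2 : ((1 + β) • 1 - X).PosSemidef := by
    have := h2.conjTranspose_mul_mul_same Q
    rw [Matrix.conjTranspose_eq_transpose_of_trivial, Matrix.mul_sub, Matrix.sub_mul,
      Matrix.mul_smul, Matrix.smul_mul, hQΓ] at this
    exact this
  have hXz : ∀ i, (X *ᵥ z) i = Qᵀ i ⬝ᵥ Λ *ᵥ (Q *ᵥ z) := by
    intro i
    rw [hX, ← Matrix.mulVec_mulVec, ← Matrix.mulVec_mulVec]
    rfl
  have hquad : (Q *ᵥ z) ⬝ᵥ M *ᵥ (Q *ᵥ z) = ∑ i, ev i * z i ^ 2 := by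
    rw [← Matrix.vecMul_transpose Q z, ← Matrix.dotProduct_mulVec, Matrix.vecMul_transpose,
      Matrix.mulVec_mulVec, Matrix.mulVec_mulVec, hQM]
    simp only [dotProduct, Matrix.mulVec_diagonal]
    exact Finset.sum_congr rfl fun i _ => by ring
  have htr : (M * Λ⁻¹).trace = ∑ i, ev i * X⁻¹ i i := by
    have hΛinv : Λ⁻¹ = Q * X⁻¹ * Qᵀ := by
      rw [hX, Matrix.mul_inv_rev, Matrix.mul_inv_rev]
      calc Λ⁻¹ = (Q * Q⁻¹) * Λ⁻¹ * ((Qᵀ)⁻¹ * Qᵀ) := by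
            rw [Matrix.mul_nonsing_inv _ hQd, Matrix.nonsing_inv_mul _ hQtd, Matrix.one_mul,
              Matrix.mul_one]
        _ = _ := by simp only [Matrix.mul_assoc]
    rw [hΛinv, ← Matrix.mul_assoc, ← Matrix.mul_assoc, Matrix.trace_mul_comm, ← Matrix.mul_assoc,
      ← Matrix.mul_assoc, hQM, Matrix.trace]
    simp [Matrix.diagonal_mul]
  rw [hquad, htr]
  exact sum_mul_sq_le_of_near_one hβ hX1 hX2 hev fun i => by rw [hXz]; exact hY i

/-! ### The exponential supermartingale of a noise sequence -/

/-- The Gaussian moment generating function, normalized. -/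
theorem NonlinearSystem.lintegral_exp_inner_sub_noiseLaw {dx dφ : ℕ} {U : Type*}
    [MeasurableSpace U] (S : NonlinearSystem dx dφ U) (v : Vec dx) :
    ∫⁻ z, ENNReal.ofReal (Real.exp (inner ℝ v z - S.σ ^ 2 / 2 * ‖v‖ ^ 2)) ∂S.noiseLaw = 1 := by
  rw [NonlinearSystem.noiseLaw, lintegral_map (by fun_prop) (by fun_prop)]
  set μ := stdGaussian (Vec dx)
  set L : StrongDual ℝ (Vec dx) := innerSL ℝ (S.σ • v) with hL
  have hmap : μ.map L = gaussianReal 0 (‖S.σ • v‖₊ ^ 2) := by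
    rw [IsGaussian.map_eq_gaussianReal L, integral_strongDual_stdGaussian,
      variance_dual_stdGaussian]
    congr 1
    ext
    simp [hL, norm_smul]
    positivity
  have hm := mgf_gaussianReal hmap 1
  have hint : Integrable (fun z => Real.exp (1 * L z)) μ := by
    by_contra hni
    have h0 : mgf L μ 1 = 0 := integral_undef hni
    rw [h0] at hm
    exact (Real.exp_pos _).ne hm
  have heq : ∀ z, Real.exp (inner ℝ v (S.σ • z) - S.σ ^ 2 / 2 * ‖v‖ ^ 2) =
      Real.exp (-(S.σ ^ 2 / 2 * ‖v‖ ^ 2)) * Real.exp (1 * L z) := fun z => by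
    rw [← Real.exp_add, hL, innerSL_apply_apply, inner_smul_left, inner_smul_right]
    congr 1
    simp
    ring
  simp_rw [heq]
  rw [← ofReal_integral_eq_lintegral_ofReal (hint.const_mul _)
    (Filter.Eventually.of_forall fun z => by positivity), integral_const_mul]
  have : ∫ z, Real.exp (1 * L z) ∂μ = mgf L μ 1 := rfl
  rw [this, hm, ← Real.exp_add]
  simp [norm_smul, mul_pow]
  ring

/-- Multiplying a past quantity by an exponential factor of conditional mean at most one. -/
theorem lintegral_mul_le_of_indep {Ω E F : Type*} {m mΩ : MeasurableSpace Ω} [MeasurableSpace E]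
    [MeasurableSpace F] {P : Measure Ω} [IsProbabilityMeasure P] (hm : m ≤ mΩ)
    {Z : Ω → ENNReal} (hZ : Measurable[m] Z) {X : Ω → E} (hX : Measurable[m] X)
    {w : Ω → F} (hw : Measurable w) {ν : Measure F} (hlaw : HasLaw w ν P)
    (hind : Indep (MeasurableSpace.comap w inferInstance) m P)
    {κ : E × F → ENNReal} (hκ : Measurable κ) (hκ1 : ∀ x, ∫⁻ z, κ (x, z) ∂ν ≤ 1) :
    ∫⁻ ω, Z ω * κ (X ω, w ω) ∂P ≤ ∫⁻ ω, Z ω ∂P := by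
  have hZX : Measurable[m] fun ω => (Z ω, X ω) := hZ.prodMk hX
  have hZX' : Measurable fun ω => (Z ω, X ω) := hZX.mono hm le_rfl
  have hν : IsProbabilityMeasure ν := by
    rw [← hlaw.map_eq]; exact Measure.isProbabilityMeasure_map hw.aemeasurable
  have hindep : IndepFun (fun ω => (Z ω, X ω)) w P := by
    rw [IndepFun_iff_Indep]
    exact indep_of_indep_of_le_left hind.symm (measurable_iff_comap_le.mp hZX)
  have hmap := hindep.map_prod_eq_prod_map_map hZX'.aemeasurable hw.aemeasurable
  rw [hlaw.map_eq] at hmap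
  have hf : Measurable fun p : (ENNReal × E) × F => p.1.1 * κ (p.1.2, p.2) := by fun_prop
  calc ∫⁻ ω, Z ω * κ (X ω, w ω) ∂P
      = ∫⁻ p, p.1.1 * κ (p.1.2, p.2) ∂(P.map fun ω => ((Z ω, X ω), w ω)) :=
        (lintegral_map hf (hZX'.prodMk hw)).symm
    _ = ∫⁻ a, ∫⁻ z, a.1 * κ (a.2, z) ∂ν ∂(P.map fun ω => (Z ω, X ω)) := by
        rw [hmap, lintegral_prod _ hf.aemeasurable]
    _ ≤ ∫⁻ a, a.1 ∂(P.map fun ω => (Z ω, X ω)) := by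
        refine lintegral_mono fun a => ?_
        rw [lintegral_const_mul _ (by fun_prop)]
        exact mul_le_of_le_one_right' (hκ1 a.2)
    _ = ∫⁻ ω, Z ω ∂P := lintegral_map measurable_fst hZX'

/-- A product of predictable factors, each of conditional mean at most one. -/
theorem lintegral_prod_le_one_of_indep {ι Ω E F : Type*} [LinearOrder ι] {mΩ : MeasurableSpace Ω}
    {P : Measure Ω} [IsProbabilityMeasure P] [MeasurableSpace E] [MeasurableSpace F]
    {ν : Measure F} {κ : E × F → ENNReal} (hκ : Measurable κ) (hκ1 : ∀ x, ∫⁻ z, κ (x, z) ∂ν ≤ 1)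
    (ℱ : Filtration ι mΩ) {X : ι → Ω → E} {w : ι → Ω → F}
    (hX : ∀ i, Measurable[ℱ i] (X i)) (hw : ∀ i, Measurable (w i))
    (hpast : ∀ i j, i < j → Measurable[ℱ j] (w i)) (hlaw : ∀ i, HasLaw (w i) ν P)
    (hind : ∀ i, Indep (MeasurableSpace.comap (w i) inferInstance) (ℱ i) P) (s : Finset ι) :
    ∫⁻ ω, ∏ i ∈ s, κ (X i ω, w i ω) ∂P ≤ 1 := by
  induction s using Finset.induction_on_max with
  | empty => simp
  | insert a s has ih =>
    have ha : a ∉ s := fun h => lt_irrefl _ (has a h)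
    have hZ : Measurable[ℱ a] fun ω => ∏ i ∈ s, κ (X i ω, w i ω) := by
      refine Finset.measurable_fun_prod s fun i hi => ?_
      have hXi : Measurable[ℱ a] (X i) := (hX i).mono (ℱ.mono (has i hi).le) le_rfl
      have hp : Measurable[ℱ a] fun ω => (X i ω, w i ω) := hXi.prodMk (hpast i a (has i hi))
      exact hκ.comp hp
    simp_rw [Finset.prod_insert ha, mul_comm (κ _) (Finset.prod _ _)]
    exact (lintegral_mul_le_of_indep (ℱ.le a) hZ (hX a) (hw a) (hlaw a) (hind a) hκ hκ1).trans ih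

/-! ### The score of the regression -/

namespace Interaction

variable {dx dφ : ℕ} {U : Type*} [MeasurableSpace U] {S : NonlinearSystem dx dφ U}
  {A : Matrix (Fin dx) (Fin dφ) ℝ} {T H : ℕ} {Ω : Type*} [mΩ : MeasurableSpace Ω] {P : Measure Ω}

/-- The score `∑ₜ ∑ₕ w_h^t ⊗ φ(x_h^t, u_h^t)` of the least-squares problem. -/
def score (I : Interaction S A T H P) (ω : Ω) : Fin dx × Fin dφ → ℝ :=
  fun p => ∑ t, ∑ h, I.w t h ω p.1 * I.feature t h ω p.2

/-- The matrix with vectorization `a`, applied to the feature of step `h` of episode `t`. -/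
def directedFeature (I : Interaction S A T H P) (a : Fin dx × Fin dφ → ℝ) (t : Fin T) (h : Fin H)
    (ω : Ω) : Vec dx :=
  WithLp.toLp 2 fun i => ∑ j, a (i, j) * I.feature t h ω j

theorem dotProduct_score (I : Interaction S A T H P) (a : Fin dx × Fin dφ → ℝ) (ω : Ω) :
    a ⬝ᵥ I.score ω = ∑ t, ∑ h, inner ℝ (I.directedFeature a t h ω) (I.w t h ω) := by
  simp only [dotProduct, score, directedFeature, PiLp.inner_apply, Fintype.sum_prod_type,
    Finset.mul_sum, RCLike.inner_apply, conj_trivial]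
  simp_rw [Finset.sum_comm (γ := Fin T), Finset.sum_comm (γ := Fin H)]
  refine Finset.sum_congr rfl fun t _ => Finset.sum_congr rfl fun h _ =>
    Finset.sum_congr rfl fun i _ => Finset.sum_congr rfl fun j _ => by ring

theorem covariance_apply (I : Interaction S A T H P) (ω : Ω) (i j : Fin dφ) :
    I.covariance ω i j = ∑ t, ∑ h, I.feature t h ω i * I.feature t h ω j := by
  simp [covariance, Matrix.sum_apply, Matrix.vecMulVec_apply]

theorem dotProduct_blockCovariance_mulVec (I : Interaction S A T H P)
    (a b : Fin dx × Fin dφ → ℝ) (ω : Ω) :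
    a ⬝ᵥ I.blockCovariance ω *ᵥ b =
      ∑ t, ∑ h, inner ℝ (I.directedFeature a t h ω) (I.directedFeature b t h ω) := by
  have h1 : ∀ p, (I.blockCovariance ω *ᵥ b) p = ∑ l, I.covariance ω p.2 l * b (p.1, l) := by
    intro p
    simp only [Matrix.mulVec, dotProduct, blockCovariance, Matrix.kroneckerMap_apply,
      Matrix.one_apply, Fintype.sum_prod_type]
    rw [Finset.sum_eq_single p.1]
    · simp
    · intro k _ hk; simp [hk.symm]
    · simp
  simp only [dotProduct, h1, covariance_apply, directedFeature, PiLp.inner_apply,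
    Fintype.sum_prod_type, Finset.mul_sum, Finset.sum_mul, RCLike.inner_apply, conj_trivial]
  simp_rw [Finset.sum_comm (γ := Fin T), Finset.sum_comm (γ := Fin H)]
  refine Finset.sum_congr rfl fun t _ => Finset.sum_congr rfl fun h _ =>
    Finset.sum_congr rfl fun i _ => ?_
  refine Finset.sum_congr rfl fun l _ => Finset.sum_congr rfl fun j _ => by ring

theorem isSymm_blockCovariance (I : Interaction S A T H P) (ω : Ω) :
    (I.blockCovariance ω)ᵀ = I.blockCovariance ω := by
  ext p q
  simp only [Matrix.transpose_apply, blockCovariance, Matrix.kroneckerMap_apply, covariance_apply,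
    Matrix.one_apply, eq_comm (a := q.1), mul_comm (I.feature _ _ ω q.2)]

theorem measurable_x (I : Interaction S A T H P) (t : Fin T) (h : Fin (H + 1)) :
    ∀ k : Fin H, h ≤ k.castSucc → Measurable[I.ℱ (toLex (t, k))] (I.x t h) := by
  induction h using Fin.induction with
  | zero =>
    intro k _
    have : I.x t 0 = fun _ => S.x₁ := funext fun ω => I.initial t ω
    rw [this]
    exact measurable_const
  | succ h ih =>
    intro k hk
    have hlt : h < k := Fin.castSucc_lt_castSucc_iff.mp (lt_of_lt_of_le Fin.castSucc_lt_succ hk)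
    have hlex : toLex (t, h) < toLex (t, k) := by
      rw [Prod.Lex.toLex_lt_toLex]; exact Or.inr ⟨rfl, hlt⟩
    have hx := ih k (Fin.castSucc_le_castSucc_iff.mpr hlt.le)
    have hu : Measurable[I.ℱ (toLex (t, k))] (I.u t h) :=
      (I.measurable_u t h).mono (I.ℱ.mono hlex.le) le_rfl
    have hw := I.measurable_w_past t h t k hlex
    have : I.x t h.succ = fun ω => S.drift A (I.x t h.castSucc ω) (I.u t h ω) + I.w t h ω :=
      funext fun ω => I.dynamics t h ω
    rw [this]
    have hφ : Measurable[I.ℱ (toLex (t, k))] fun ω => S.φ (I.x t h.castSucc ω) (I.u t h ω) :=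
      S.measurable_φ.comp (hx.prodMk hu)
    have hA : Continuous fun y : Vec dφ => (WithLp.toLp 2 (A *ᵥ y.ofLp) : Vec dx) := by fun_prop
    exact (hA.measurable.comp hφ).add hw

theorem measurable_feature (I : Interaction S A T H P) (t : Fin T) (h : Fin H) :
    Measurable[I.ℱ (toLex (t, h))] (I.feature t h) :=
  S.measurable_φ.comp ((I.measurable_x t h.castSucc h le_rfl).prodMk (I.measurable_u t h))

theorem measurable_feature_apply (I : Interaction S A T H P) (t : Fin T) (h : Fin H)
    (j : Fin dφ) : Measurable fun ω => I.feature t h ω j :=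
  (EuclideanSpace.proj (𝕜 := ℝ) j).measurable.comp
    ((I.measurable_feature t h).mono (I.ℱ.le _) le_rfl)

theorem measurable_covariance_apply (I : Interaction S A T H P) (i j : Fin dφ) :
    Measurable fun ω => I.covariance ω i j := by
  simp_rw [covariance_apply]
  exact Finset.measurable_fun_sum _ fun t _ => Finset.measurable_fun_sum _ fun h _ =>
    (I.measurable_feature_apply t h i).mul (I.measurable_feature_apply t h j)

theorem measurable_blockCovariance_apply (I : Interaction S A T H P) (p q : Fin dx × Fin dφ) :
    Measurable fun ω => I.blockCovariance ω p q := by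
  simp only [blockCovariance, Matrix.kroneckerMap_apply]
  exact (I.measurable_covariance_apply _ _).const_mul _

theorem measurable_score_apply (I : Interaction S A T H P) (p : Fin dx × Fin dφ) :
    Measurable fun ω => I.score ω p :=
  Finset.measurable_fun_sum _ fun t _ => Finset.measurable_fun_sum _ fun h _ =>
    ((EuclideanSpace.proj (𝕜 := ℝ) p.1).measurable.comp (I.measurable_w t h)).mul
      (I.measurable_feature_apply t h _)

theorem lintegral_exp_score_le_one [IsProbabilityMeasure P] (I : Interaction S A T H P)
    (a : Fin dx × Fin dφ → ℝ) :
    ∫⁻ ω, ENNReal.ofReal (Real.exp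
      (a ⬝ᵥ I.score ω - S.σ ^ 2 / 2 * (a ⬝ᵥ I.blockCovariance ω *ᵥ a))) ∂P ≤ 1 := by
  have hX : ∀ i : Fin T ×ₗ Fin H, Measurable[I.ℱ i]
      (I.directedFeature a (ofLex i).1 (ofLex i).2) := by
    intro i
    have hc : Continuous fun y : Vec dφ =>
        (WithLp.toLp 2 (fun i => ∑ j, a (i, j) * y j) : Vec dx) := by fun_prop
    exact hc.measurable.comp (I.measurable_feature (ofLex i).1 (ofLex i).2)
  refine le_trans (le_of_eq (lintegral_congr fun ω => ?_))
    (lintegral_prod_le_one_of_indep (κ := fun p : Vec dx × Vec dx =>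
        ENNReal.ofReal (Real.exp (inner ℝ p.1 p.2 - S.σ ^ 2 / 2 * ‖p.1‖ ^ 2))) (by fun_prop)
      (fun v => (S.lintegral_exp_inner_sub_noiseLaw v).le) I.ℱ
      (w := fun i => I.w (ofLex i).1 (ofLex i).2) hX
      (fun i => I.measurable_w _ _)
      (fun i j hij => I.measurable_w_past _ _ (ofLex j).1 (ofLex j).2 hij)
      (fun i => I.law_w _ _) (fun i => I.indep_w _ _) Finset.univ)
  have hsum : ∀ f : Fin T → Fin H → ℝ,
      ∑ i : Fin T ×ₗ Fin H, f (ofLex i).1 (ofLex i).2 = ∑ t, ∑ h, f t h := fun f => by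
    rw [← Fintype.sum_prod_type', ← (toLex (α := Fin T × Fin H)).sum_comp]
    rfl
  rw [← ENNReal.ofReal_prod_of_nonneg fun _ _ => (Real.exp_pos _).le, ← Real.exp_sum,
    Finset.sum_sub_distrib, ← Finset.mul_sum, I.dotProduct_score,
    I.dotProduct_blockCovariance_mulVec,
    hsum fun t h => inner ℝ (I.directedFeature a t h ω) (I.w t h ω),
    hsum fun t h => ‖I.directedFeature a t h ω‖ ^ 2]
  simp_rw [real_inner_self_eq_norm_sq]

/-- The normal equations. -/
theorem blockCovariance_mulVec_of_isLeastSquares (I : Interaction S A T H P)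
    {Ahat : Ω → Matrix (Fin dx) (Fin dφ) ℝ} (hA : I.IsLeastSquares Ahat) (ω : Ω) :
    I.blockCovariance ω *ᵥ (vecMat (Ahat ω - A)).ofLp = I.score ω := by
  have hloss : ∀ b : Fin dx × Fin dφ → ℝ, I.lsLoss ω (A + Matrix.of fun i j => b (i, j)) =
      ∑ t, ∑ h, ‖I.w t h ω‖ ^ 2 - 2 * (b ⬝ᵥ I.score ω) + b ⬝ᵥ I.blockCovariance ω *ᵥ b := by
    intro b
    have hres : ∀ t h, I.x t h.succ ω - S.drift (A + Matrix.of fun i j => b (i, j))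
        (I.x t h.castSucc ω) (I.u t h ω) = I.w t h ω - I.directedFeature b t h ω := by
      intro t h
      rw [I.dynamics]
      ext i
      simp [NonlinearSystem.drift, directedFeature, feature, Matrix.add_mulVec, Matrix.mulVec,
        dotProduct]
    simp only [lsLoss, hres, I.dotProduct_score, I.dotProduct_blockCovariance_mulVec,
      @norm_sub_sq ℝ, real_inner_self_eq_norm_sq, Finset.sum_add_distrib, Finset.sum_sub_distrib,
      Finset.mul_sum, RCLike.re_to_real, real_inner_comm]
  set b := (vecMat (Ahat ω - A)).ofLp with hb
  have hAb : Ahat ω = A + Matrix.of fun i j => b (i, j) := by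
    ext i j; simp [hb, vecMat]
  set r := I.blockCovariance ω *ᵥ b - I.score ω with hr
  have hmin : ∀ t : ℝ, 0 ≤ (r ⬝ᵥ I.blockCovariance ω *ᵥ r) * (t * t) + 2 * (r ⬝ᵥ r) * t + 0 := by
    intro t
    have h := hA ω (A + Matrix.of fun i j => (b + t • r) (i, j))
    have hsymm : b ⬝ᵥ I.blockCovariance ω *ᵥ r = r ⬝ᵥ I.blockCovariance ω *ᵥ b := by
      rw [Matrix.dotProduct_mulVec, ← Matrix.mulVec_transpose, I.isSymm_blockCovariance,
        dotProduct_comm]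
    rw [hAb, hloss, hloss] at h
    simp only [Matrix.mulVec_add, Matrix.mulVec_smul, add_dotProduct, dotProduct_add,
      smul_dotProduct, dotProduct_smul, smul_eq_mul, hsymm] at h
    have hrr : r ⬝ᵥ r = r ⬝ᵥ I.blockCovariance ω *ᵥ b - r ⬝ᵥ I.score ω := by
      conv_lhs => rw [hr, dotProduct_sub, ← hr]
    rw [hrr]
    linarith
  -- the residual `r` of the normal equations is a descent direction unless it vanishes
  have hd := discrim_le_zero hmin
  rw [discrim] at hd
  have h0 : r ⬝ᵥ r = 0 := by nlinarith
  exact sub_eq_zero.mp (dotProduct_self_eq_zero.mp h0)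

end Interaction

/-! ### Tail bounds from the exponential supermartingale -/

theorem measure_le_ofReal_of_lintegral_le {Ω : Type*} {mΩ : MeasurableSpace Ω} {P : Measure Ω}
    {f : Ω → ENNReal} (hf : Measurable f) {z δ : ℝ} (hz : 0 < z) (hδ : 0 < δ)
    (h : ∫⁻ ω, f ω ∂P ≤ ENNReal.ofReal z) :
    P {ω | ENNReal.ofReal (z / δ) ≤ f ω} ≤ ENNReal.ofReal δ := by
  have hpos : 0 < z / δ := by positivity
  refine (meas_ge_le_lintegral_div hf.aemeasurable (by simpa using hpos)
    ENNReal.ofReal_ne_top).trans ?_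
  refine ENNReal.div_le_of_le_mul (h.trans (le_of_eq ?_))
  rw [← ENNReal.ofReal_mul hδ.le]
  congr 1
  field_simp

theorem lintegral_exp_neg_mul_sq_norm {ι : Type*} [Fintype ι] {b : ℝ} (hb : 0 < b) :
    ∫⁻ a : EuclideanSpace ℝ ι, ENNReal.ofReal (Real.exp (-b * ‖a‖ ^ 2)) =
      ENNReal.ofReal ((Real.pi / b) ^ (Fintype.card ι / 2 : ℝ)) := by
  have h := GaussianFourier.integral_rexp_neg_mul_sq_norm (V := EuclideanSpace ℝ ι) hb
  rw [finrank_euclideanSpace] at h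
  rw [← h, ofReal_integral_eq_lintegral_ofReal]
  · by_contra hni
    rw [integral_undef hni] at h
    have : 0 < (Real.pi / b) ^ (Fintype.card ι / 2 : ℝ) := by positivity
    exact this.ne h
  · exact Filter.Eventually.of_forall fun a => (Real.exp_pos _).le

/-- An odd exponent can only increase the integral of an even function, since `cosh ≥ 1`. -/
theorem lintegral_le_lintegral_exp_mul_of_even {E : Type*} [AddGroup E] [MeasurableSpace E]
    [MeasurableNeg E] {μ : Measure E} [μ.IsNegInvariant] {l : E → ℝ} {G : E → ENNReal}
    (hl : Measurable l) (hG : Measurable G) (hodd : ∀ u, l (-u) = -l u)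
    (heven : ∀ u, G (-u) = G u) :
    ∫⁻ u, G u ∂μ ≤ ∫⁻ u, ENNReal.ofReal (Real.exp (l u)) * G u ∂μ := by
  have hneg : ∫⁻ u, ENNReal.ofReal (Real.exp (-l u)) * G u ∂μ =
      ∫⁻ u, ENNReal.ofReal (Real.exp (l u)) * G u ∂μ := by
    rw [← lintegral_neg_eq_self]
    simp_rw [hodd, heven, neg_neg]
  have h2 : 2 * ∫⁻ u, G u ∂μ ≤ 2 * ∫⁻ u, ENNReal.ofReal (Real.exp (l u)) * G u ∂μ := by
    rw [two_mul (lintegral μ fun u => ENNReal.ofReal (Real.exp (l u)) * G u)]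
    nth_rewrite 2 [← hneg]
    rw [← lintegral_add_left (by fun_prop), ← lintegral_const_mul _ hG]
    refine lintegral_mono fun u => ?_
    rw [← add_mul, ← ENNReal.ofReal_add (Real.exp_pos _).le (Real.exp_pos _).le]
    gcongr
    rw [show (2 : ENNReal) = ENNReal.ofReal 2 by simp]
    refine ENNReal.ofReal_le_ofReal ?_
    linarith [Real.one_le_cosh (l u), Real.cosh_eq (l u)]
  exact (ENNReal.mul_le_mul_iff_right (by simp) (by simp)).mp h2

section Tail

variable {ι Ω : Type*} [Fintype ι] [mΩ : MeasurableSpace Ω] {P : Measure Ω} {s : ℝ}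
  {g : Ω → ι → ℝ} {Λ : Ω → Matrix ι ι ℝ}

theorem measurable_score_exponent (hg : ∀ i, Measurable fun ω => g ω i)
    (hΛ : ∀ i j, Measurable fun ω => Λ ω i j) :
    Measurable fun p : Ω × EuclideanSpace ℝ ι =>
      p.2.ofLp ⬝ᵥ g p.1 - s / 2 * (p.2.ofLp ⬝ᵥ Λ p.1 *ᵥ p.2.ofLp) := by
  have hp : ∀ i, Measurable fun p : Ω × EuclideanSpace ℝ ι => p.2.ofLp i := fun i =>
    (EuclideanSpace.proj (𝕜 := ℝ) i).measurable.comp measurable_snd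
  have hg' : ∀ i, Measurable fun p : Ω × EuclideanSpace ℝ ι => g p.1 i := fun i =>
    (hg i).comp measurable_fst
  have hΛ' : ∀ i j, Measurable fun p : Ω × EuclideanSpace ℝ ι => Λ p.1 i j := fun i j =>
    (hΛ i j).comp measurable_fst
  simp only [dotProduct, Matrix.mulVec]
  exact (Finset.measurable_fun_sum _ fun i _ => (hp i).mul (hg' i)).sub
    ((Finset.measurable_fun_sum _ fun i _ => (hp i).mul
      (Finset.measurable_fun_sum _ fun j _ => (hΛ' i j).mul (hp j))).const_mul _)

theorem measure_log_le_score_exponent (hg : ∀ i, Measurable fun ω => g ω i)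
    (hΛ : ∀ i j, Measurable fun ω => Λ ω i j)
    (hexp : ∀ a : ι → ℝ,
      ∫⁻ ω, ENNReal.ofReal (Real.exp (a ⬝ᵥ g ω - s / 2 * (a ⬝ᵥ Λ ω *ᵥ a))) ∂P ≤ 1)
    (a : ι → ℝ) {δ : ℝ} (hδ : 0 < δ) :
    P {ω | Real.log (1 / δ) ≤ a ⬝ᵥ g ω - s / 2 * (a ⬝ᵥ Λ ω *ᵥ a)} ≤ ENNReal.ofReal δ := by
  have hm : Measurable fun ω => a ⬝ᵥ g ω - s / 2 * (a ⬝ᵥ Λ ω *ᵥ a) :=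
    (measurable_score_exponent hg hΛ).comp
      (measurable_id.prodMk (measurable_const (a := WithLp.toLp 2 a)))
  refine (measure_mono fun ω hω => ?_).trans (measure_le_ofReal_of_lintegral_le
    (hm.exp.ennreal_ofReal) one_pos hδ (by simpa using hexp a))
  refine ENNReal.ofReal_le_ofReal ?_
  rw [← Real.exp_log (show 0 < 1 / δ by positivity)]
  exact Real.exp_le_exp.mpr hω

/-- The method of mixtures with a Gaussian prior `exp(-s c |a|² / 2)` on the direction `a`.
The mixed supermartingale is bounded below by translating the prior to `e / (2 s)`, where the
exponent is at least `e · Λ e / (4 s)`, and dropping the resulting linear term by symmetry. -/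
theorem measure_log_le_selfNormalized (hs : 0 < s) (hg : ∀ i, Measurable fun ω => g ω i)
    (hΛ : ∀ i j, Measurable fun ω => Λ ω i j) (hsymm : ∀ ω, (Λ ω)ᵀ = Λ ω)
    [SFinite P] (hexp : ∀ a : ι → ℝ,
      ∫⁻ ω, ENNReal.ofReal (Real.exp (a ⬝ᵥ g ω - s / 2 * (a ⬝ᵥ Λ ω *ᵥ a))) ∂P ≤ 1)
    {c M δ : ℝ} (hc : 0 < c) (hM0 : 0 ≤ M) (hM : ∀ ω a, a ⬝ᵥ Λ ω *ᵥ a ≤ M * (a ⬝ᵥ a))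
    (hδ : 0 < δ) :
    P {ω | ∃ e, Λ ω *ᵥ e = g ω ∧ c * (e ⬝ᵥ e) ≤ e ⬝ᵥ Λ ω *ᵥ e ∧
        Real.log (1 / δ) + Fintype.card ι / 2 * Real.log (1 + M / c) ≤
          e ⬝ᵥ Λ ω *ᵥ e / (4 * s)} ≤ ENNReal.ofReal δ := by
  set d : ℝ := Fintype.card ι / 2 with hd
  set ex : Ω × EuclideanSpace ℝ ι → ℝ := fun p =>
    p.2.ofLp ⬝ᵥ g p.1 - s / 2 * (p.2.ofLp ⬝ᵥ Λ p.1 *ᵥ p.2.ofLp) with hex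
  have hexm : Measurable ex := measurable_score_exponent hg hΛ
  set J : Ω × EuclideanSpace ℝ ι → ENNReal := fun p =>
    ENNReal.ofReal (Real.exp (ex p)) * ENNReal.ofReal (Real.exp (-(s * c / 2) * ‖p.2‖ ^ 2)) with hJ
  have hJm : Measurable J := by fun_prop
  have hz : 0 < (Real.pi / (s * c / 2)) ^ d := by positivity
  have hF : ∫⁻ ω, (∫⁻ a, J (ω, a)) ∂P ≤ ENNReal.ofReal ((Real.pi / (s * c / 2)) ^ d) := by
    rw [lintegral_lintegral_swap hJm.aemeasurable,
      ← lintegral_exp_neg_mul_sq_norm (ι := ι) (by positivity : 0 < s * c / 2)]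
    refine lintegral_mono fun a => ?_
    simp only [hJ]
    rw [lintegral_mul_const _ (by fun_prop)]
    exact mul_le_of_le_one_left' (hexp a.ofLp)
  refine (measure_mono fun ω hω => ?_).trans
    (measure_le_ofReal_of_lintegral_le hJm.lintegral_prod_right' hz hδ hF)
  obtain ⟨e, he, hce, hlog⟩ := hω
  set q := e ⬝ᵥ Λ ω *ᵥ e with hq
  set a₀ : EuclideanSpace ℝ ι := WithLp.toLp 2 ((1 / (2 * s)) • e) with ha₀
  set l : EuclideanSpace ℝ ι → ℝ := fun u =>
    u.ofLp ⬝ᵥ g ω - s * (u.ofLp ⬝ᵥ Λ ω *ᵥ a₀.ofLp) - s * c * (u.ofLp ⬝ᵥ a₀.ofLp) with hl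
  have hnorm : ∀ u : EuclideanSpace ℝ ι, ‖u‖ ^ 2 = u.ofLp ⬝ᵥ u.ofLp := fun u => by
    rw [EuclideanSpace.real_norm_sq_eq, dotProduct_self_eq_sum_sq]
  have hlm : Measurable l := by
    refine Continuous.measurable ?_
    simp only [hl, dotProduct]
    fun_prop
  have hlodd : ∀ u, l (-u) = -l u := fun u => by
    simp only [hl, WithLp.ofLp_neg, neg_dotProduct]; ring
  have hpt : ∀ u, q / (4 * s) + l u - s * (c + M) / 2 * ‖u‖ ^ 2 ≤
      ex (ω, u + a₀) - s * c / 2 * ‖u + a₀‖ ^ 2 := by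
    intro u
    have hsw : a₀.ofLp ⬝ᵥ Λ ω *ᵥ u.ofLp = u.ofLp ⬝ᵥ Λ ω *ᵥ a₀.ofLp := by
      rw [Matrix.dotProduct_mulVec, ← Matrix.mulVec_transpose, hsymm, dotProduct_comm]
    have h1 : a₀.ofLp ⬝ᵥ g ω = q / (2 * s) := by
      rw [← he]; simp only [ha₀, smul_dotProduct, smul_eq_mul]; ring
    have h2 : a₀.ofLp ⬝ᵥ Λ ω *ᵥ a₀.ofLp = q / (4 * s ^ 2) := by
      simp only [ha₀, smul_dotProduct, Matrix.mulVec_smul, dotProduct_smul, smul_eq_mul, ← hq]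
      ring
    have h3 : a₀.ofLp ⬝ᵥ a₀.ofLp = (e ⬝ᵥ e) / (4 * s ^ 2) := by
      simp only [ha₀, smul_dotProduct, dotProduct_smul, smul_eq_mul]; ring
    have h4 := hM ω u.ofLp
    have h5 : s * c / 2 * ((e ⬝ᵥ e) / (4 * s ^ 2)) ≤ q / (8 * s) := by
      have : s * c / 2 * ((e ⬝ᵥ e) / (4 * s ^ 2)) = (c * (e ⬝ᵥ e)) / (8 * s) := by
        field_simp; ring
      rw [this]
      gcongr
    have h6 : s / 2 * (q / (4 * s ^ 2)) = q / (8 * s) := by field_simp; ring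
    have h7 : q / (4 * s) = q / (2 * s) - q / (8 * s) - q / (8 * s) := by field_simp; ring
    simp only [hex, hnorm, WithLp.ofLp_add, Matrix.mulVec_add, add_dotProduct, dotProduct_add, hsw,
      h1, h2, h3, dotProduct_comm a₀.ofLp u.ofLp]
    have h8 := mul_le_mul_of_nonneg_left h4 (half_pos hs).le
    rw [h7]
    simp only [hl]
    linarith
  -- translate the prior to `a₀`, then drop the odd part `l` of the exponent
  have hshift : ∫⁻ a, J (ω, a) = ∫⁻ u, J (ω, u + a₀) :=
    (lintegral_add_right_eq_self (μ := (volume : Measure (EuclideanSpace ℝ ι)))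
      (fun a => J (ω, a)) a₀).symm
  have hb : 0 < s * (c + M) / 2 := by positivity
  have hlow : ENNReal.ofReal (Real.exp (q / (4 * s))) *
      ENNReal.ofReal ((Real.pi / (s * (c + M) / 2)) ^ d) ≤ ∫⁻ a, J (ω, a) := by
    rw [hshift, ← lintegral_exp_neg_mul_sq_norm (ι := ι) hb]
    calc _ ≤ ENNReal.ofReal (Real.exp (q / (4 * s))) * ∫⁻ u : EuclideanSpace ℝ ι,
          ENNReal.ofReal (Real.exp (l u)) *
            ENNReal.ofReal (Real.exp (-(s * (c + M) / 2) * ‖u‖ ^ 2)) := by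
          refine mul_le_mul' le_rfl (lintegral_le_lintegral_exp_mul_of_even
            (G := fun u => ENNReal.ofReal (Real.exp (-(s * (c + M) / 2) * ‖u‖ ^ 2)))
            hlm (by fun_prop) hlodd (by simp))
      _ = ∫⁻ u : EuclideanSpace ℝ ι, ENNReal.ofReal (Real.exp (q / (4 * s))) *
          (ENNReal.ofReal (Real.exp (l u)) *
            ENNReal.ofReal (Real.exp (-(s * (c + M) / 2) * ‖u‖ ^ 2))) :=
          (lintegral_const_mul _ (by fun_prop)).symm
      _ ≤ _ := by
          refine lintegral_mono fun u => ?_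
          simp only [hJ]
          rw [← ENNReal.ofReal_mul (Real.exp_pos _).le, ← ENNReal.ofReal_mul (Real.exp_pos _).le,
            ← ENNReal.ofReal_mul (Real.exp_pos _).le, ← Real.exp_add, ← Real.exp_add,
            ← Real.exp_add]
          refine ENNReal.ofReal_le_ofReal (Real.exp_le_exp.mpr ?_)
          linarith [hpt u]
  refine le_trans ?_ hlow
  rw [← ENNReal.ofReal_mul (Real.exp_pos _).le]
  refine ENNReal.ofReal_le_ofReal ?_
  have hratio : (Real.pi / (s * c / 2)) ^ d =
      (1 + M / c) ^ d * (Real.pi / (s * (c + M) / 2)) ^ d := by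
    rw [← Real.mul_rpow (by positivity) (by positivity)]
    congr 1
    field_simp
  have hexpge : 1 / δ * (1 + M / c) ^ d ≤ Real.exp (q / (4 * s)) := by
    rw [Real.rpow_def_of_pos (by positivity), ← Real.exp_log (show 0 < 1 / δ by positivity),
      ← Real.exp_add, mul_comm (Real.log (1 + M / c))]
    exact Real.exp_le_exp.mpr hlog
  rw [hratio]
  calc (1 + M / c) ^ d * (Real.pi / (s * (c + M) / 2)) ^ d / δ
      = (1 / δ * (1 + M / c) ^ d) * (Real.pi / (s * (c + M) / 2)) ^ d := by ring
    _ ≤ _ := by gcongr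

/-- The mixtures at the scales `c = M / 2 ^ (n + 1)`, where `M` bounds the eigenvalues of `Λ`, with
failure probabilities `δ / 2 ^ (n + 1)`. The scale with `c ≤ lam ≤ 2 c` serves the outcomes with
`lam I ⪯ Λ`, and its extra `log 2 ^ (n + 1)` is at most a multiple of `log (2 + M / lam)`. -/
theorem measure_selfNormalized_stitched [Nonempty ι] (hs : 0 < s)
    (hg : ∀ i, Measurable fun ω => g ω i)
    (hΛ : ∀ i j, Measurable fun ω => Λ ω i j) (hsymm : ∀ ω, (Λ ω)ᵀ = Λ ω)
    [SFinite P] (hexp : ∀ a : ι → ℝ,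
      ∫⁻ ω, ENNReal.ofReal (Real.exp (a ⬝ᵥ g ω - s / 2 * (a ⬝ᵥ Λ ω *ᵥ a))) ∂P ≤ 1)
    {M δ : ℝ} (hM : ∀ ω a, a ⬝ᵥ Λ ω *ᵥ a ≤ M * (a ⬝ᵥ a)) (hδ : 0 < δ) (hδ1 : δ < 1) :
    P {ω | ∃ lam e, 0 < lam ∧ (∀ a, lam * (a ⬝ᵥ a) ≤ a ⬝ᵥ Λ ω *ᵥ a) ∧ Λ ω *ᵥ e = g ω ∧
        12 * s * (Real.log (1 / δ) + Fintype.card ι * Real.log (2 + M / lam)) <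
          e ⬝ᵥ Λ ω *ᵥ e} ≤ ENNReal.ofReal δ := by
  classical
  have hone : ∃ v : ι → ℝ, v ⬝ᵥ v = 1 :=
    ⟨Pi.single (Classical.arbitrary ι) 1, by simp⟩
  obtain ⟨v, hv⟩ := hone
  -- for `M ≤ 0` no `Λ` is positive definite
  rcases le_or_gt M 0 with hM0 | hM0
  · refine le_trans (le_of_eq ?_) (zero_le (a := ENNReal.ofReal δ))
    convert! measure_empty (μ := P)
    refine Set.eq_empty_of_forall_notMem ?_
    rintro ω ⟨lam, e, hlam, h, -⟩
    have h1 := h v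
    have h2 := hM ω v
    rw [hv] at h1 h2
    linarith
  set E : ℕ → Set Ω := fun n => {ω | ∃ e, Λ ω *ᵥ e = g ω ∧
    M / 2 ^ (n + 1) * (e ⬝ᵥ e) ≤ e ⬝ᵥ Λ ω *ᵥ e ∧
      Real.log (1 / (δ / 2 ^ (n + 1))) + Fintype.card ι / 2 * Real.log (1 + M / (M / 2 ^ (n + 1))) ≤
        e ⬝ᵥ Λ ω *ᵥ e / (4 * s)} with hE
  have hEn : ∀ n, P (E n) ≤ ENNReal.ofReal (δ / 2 ^ (n + 1)) := fun n =>
    measure_log_le_selfNormalized hs hg hΛ hsymm hexp (by positivity) hM0.le hM (by positivity)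
  have hsum : HasSum (fun n : ℕ => δ / 2 ^ (n + 1)) δ := by
    have h := (hasSum_geometric_two).mul_left (δ / 2)
    convert! h using 1
    · ext n; rw [pow_succ, one_div, inv_pow]; field_simp
    · ring
  have htot : ∑' n, ENNReal.ofReal (δ / 2 ^ (n + 1)) = ENNReal.ofReal δ := by
    rw [← ENNReal.ofReal_tsum_of_nonneg (fun n => by positivity) hsum.summable, hsum.tsum_eq]
  refine (measure_mono ?_).trans
    ((measure_iUnion_le E).trans ((ENNReal.tsum_le_tsum hEn).trans htot.le))
  rintro ω ⟨lam, e, hlam, hl, he, hlt⟩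
  have hlM : lam ≤ M := by
    have h1 := hl v
    have h2 := hM ω v
    rw [hv] at h1 h2
    linarith
  obtain ⟨n, hn1, hn2⟩ := exists_nat_pow_near ((one_le_div hlam).mpr hlM) one_lt_two
  refine Set.mem_iUnion.mpr ⟨n, e, he, le_trans ?_ (hl e), ?_⟩
  · refine mul_le_mul_of_nonneg_right ?_ (by rw [dotProduct_self_eq_sum_sq]; positivity)
    rw [div_le_iff₀ (by positivity)]
    rw [div_lt_iff₀ hlam] at hn2
    linarith
  · set x := M / lam with hx
    have hx1 : 1 ≤ x := (one_le_div hlam).mpr hlM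
    have hMM : M / (M / 2 ^ (n + 1)) = 2 ^ (n + 1) := by field_simp
    have hpow : (2 : ℝ) ^ (n + 1) ≤ 2 * x := by rw [pow_succ]; linarith
    have hcard : (1 : ℝ) ≤ Fintype.card ι := by exact_mod_cast Fintype.card_pos
    have hlog0 : 0 ≤ Real.log (2 + x) := Real.log_nonneg (by linarith)
    have hlogδ : 0 ≤ Real.log (1 / δ) := Real.log_nonneg (by rw [le_div_iff₀ hδ]; linarith)
    have e1 : Real.log (1 / (δ / 2 ^ (n + 1))) ≤ Real.log (1 / δ) + 2 * Real.log (2 + x) := by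
      rw [show 1 / (δ / 2 ^ (n + 1)) = 1 / δ * 2 ^ (n + 1) by field_simp,
        Real.log_mul (by positivity) (by positivity)]
      have : Real.log (2 ^ (n + 1)) ≤ Real.log ((2 + x) ^ 2) :=
        Real.log_le_log (by positivity) (by nlinarith)
      rw [Real.log_pow (n := 2)] at this
      push_cast at this
      linarith
    have e2 : Real.log (1 + M / (M / 2 ^ (n + 1))) ≤ 2 * Real.log (2 + x) := by
      rw [hMM]
      have : Real.log (1 + 2 ^ (n + 1)) ≤ Real.log ((2 + x) ^ 2) :=
        Real.log_le_log (by positivity) (by nlinarith)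
      rw [Real.log_pow] at this
      push_cast at this
      linarith
    have e3 : (Fintype.card ι : ℝ) / 2 * Real.log (1 + M / (M / 2 ^ (n + 1))) ≤
        Fintype.card ι * Real.log (2 + x) := by
      have := mul_le_mul_of_nonneg_left e2 (show 0 ≤ (Fintype.card ι : ℝ) / 2 by positivity)
      linarith
    have e4 : Real.log (2 + x) ≤ Fintype.card ι * Real.log (2 + x) :=
      le_mul_of_one_le_left hlog0 hcard
    rw [le_div_iff₀ (by positivity)]
    have e5 := mul_le_mul_of_nonneg_right (show
      Real.log (1 / (δ / 2 ^ (n + 1))) + Fintype.card ι / 2 * Real.log (1 + M / (M / 2 ^ (n + 1))) ≤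
      3 * (Real.log (1 / δ) + Fintype.card ι * Real.log (2 + x)) by linarith [e1, e3, e4])
      (show 0 ≤ 4 * s by positivity)
    refine le_trans e5 ?_
    linarith

/-- The supermartingale bound in the `2 d` directions `± √(log(2 d / δ) / s) bᵢ`, where the `bᵢ`
are `Γ`-orthonormal and diagonalize `M`. -/
theorem measure_weighted_error_near [DecidableEq ι] [Nonempty ι] (hs : 0 < s)
    (hg : ∀ i, Measurable fun ω => g ω i) (hΛ : ∀ i j, Measurable fun ω => Λ ω i j)
    (hexp : ∀ a : ι → ℝ,
      ∫⁻ ω, ENNReal.ofReal (Real.exp (a ⬝ᵥ g ω - s / 2 * (a ⬝ᵥ Λ ω *ᵥ a))) ∂P ≤ 1)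
    {M Γ : Matrix ι ι ℝ} (hM : M.PosSemidef) (hΓ : Γ.PosDef) {β δ : ℝ} (hβ : β ≤ 1 / 4)
    (hδ : 0 < δ) (hδ1 : δ < 1) :
    P {ω | (Λ ω - (1 - β) • Γ).PosSemidef ∧ ((1 + β) • Γ - Λ ω).PosSemidef ∧
        ∃ e, Λ ω *ᵥ e = g ω ∧
          15 * (1 + β ^ 2 * Fintype.card ι) * Real.log (2 * Fintype.card ι / δ) * s *
            (M * (Λ ω)⁻¹).trace < e ⬝ᵥ M *ᵥ e} ≤ ENNReal.ofReal δ := by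
  obtain ⟨Q, ev, hQ, hQΓ, hQM, hev⟩ := hΓ.exists_simultaneous_diagonalization hM
  have hcard : (1 : ℝ) ≤ Fintype.card ι := by exact_mod_cast Fintype.card_pos
  set d : ℝ := (Fintype.card ι : ℝ) with hd
  set L := Real.log (2 * d / δ) with hL
  have hL0 : 0 < L := Real.log_pos (by rw [lt_div_iff₀ hδ]; linarith)
  -- this scaling makes the quadratic term at most `5 L / 8` where `bᵢ · Λ bᵢ ≤ 1 + β ≤ 5 / 4`, so
  -- that `|bᵢ · g| ≤ (13 / 8) √(s L)`
  set t := Real.sqrt (L / s) with ht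
  have ht2 : t * t = L / s := Real.mul_self_sqrt (by positivity)
  set dir : ι × Bool → ι → ℝ := fun k => (if k.2 then t else -t) • Qᵀ k.1 with hdir
  set E : ι × Bool → Set Ω := fun k => {ω | Real.log (1 / (δ / (2 * d))) ≤
    dir k ⬝ᵥ g ω - s / 2 * (dir k ⬝ᵥ Λ ω *ᵥ dir k)} with hE
  have hEk : ∀ k, P (E k) ≤ ENNReal.ofReal (δ / (2 * d)) := fun k =>
    measure_log_le_score_exponent hg hΛ hexp (dir k) (by positivity)
  have htot : P (⋃ k, E k) ≤ ENNReal.ofReal δ := by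
    refine (measure_iUnion_fintype_le P E).trans ((Finset.sum_le_sum fun k _ => hEk k).trans ?_)
    rw [Finset.sum_const, nsmul_eq_mul, Finset.card_univ, Fintype.card_prod, Fintype.card_bool,
      ← ENNReal.ofReal_natCast, ← ENNReal.ofReal_mul (by positivity)]
    refine ENNReal.ofReal_le_ofReal (le_of_eq ?_)
    push_cast
    field_simp
    exact hd.symm
  refine (measure_mono ?_).trans htot
  rintro ω ⟨h1, h2, e, he, hlt⟩
  by_contra hnot
  simp only [Set.mem_iUnion, not_exists] at hnot
  have hlog : Real.log (1 / (δ / (2 * d))) = L := by rw [hL]; congr 1; field_simp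
  have hY : ∀ i, (Qᵀ i ⬝ᵥ Λ ω *ᵥ e) ^ 2 ≤ 3 * s * L := by
    intro i
    rw [he]
    set y := Qᵀ i ⬝ᵥ g ω with hy
    have hQi : Qᵀ i ⬝ᵥ Γ *ᵥ Qᵀ i = 1 := by
      have : (Qᵀ * Γ * Q) i i = 1 := by rw [hQΓ]; simp
      rw [Matrix.mul_assoc, Matrix.mul_apply] at this
      rw [← this]
      simp [dotProduct, Matrix.mulVec, Matrix.mul_apply]
    have hv : Qᵀ i ⬝ᵥ Λ ω *ᵥ Qᵀ i ≤ 5 / 4 := by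
      have := h2.dotProduct_mulVec_nonneg (Qᵀ i)
      simp only [star_trivial, Matrix.sub_mulVec, Matrix.smul_mulVec, dotProduct_sub,
        dotProduct_smul, smul_eq_mul, hQi] at this
      linarith
    have hp := hnot (i, true)
    have hn := hnot (i, false)
    simp only [hE, hdir, Set.mem_ofPred_eq, not_le, hlog, if_true, Bool.false_eq_true, if_false,
      smul_dotProduct, Matrix.mulVec_smul, dotProduct_smul, smul_eq_mul, ← hy] at hp hn
    have hq : s / 2 * (t * (t * (Qᵀ i ⬝ᵥ Λ ω *ᵥ Qᵀ i))) ≤ 5 / 8 * L := by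
      have : s / 2 * (t * (t * (Qᵀ i ⬝ᵥ Λ ω *ᵥ Qᵀ i))) = L / 2 * (Qᵀ i ⬝ᵥ Λ ω *ᵥ Qᵀ i) := by
        rw [← mul_assoc t, ht2]; field_simp
      rw [this]
      nlinarith
    have hty : (t * y) ^ 2 ≤ (13 / 8 * L) ^ 2 := sq_le_sq' (by linarith) (by linarith)
    have hy2 : L / s * y ^ 2 ≤ L / s * (3 * s * L) := by
      calc L / s * y ^ 2 = (t * y) ^ 2 := by rw [← ht2]; ring
        _ ≤ (13 / 8 * L) ^ 2 := hty
        _ ≤ 3 * L ^ 2 := by nlinarith [sq_nonneg L]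
        _ = _ := by field_simp
    exact le_of_mul_le_mul_left hy2 (by positivity)
  have := dotProduct_mulVec_le_trace_of_near hQ hQΓ hQM hev hβ h1 h2 e hY
  refine absurd hlt (not_lt.mpr (this.trans (le_of_eq ?_)))
  ring

end Tail

/-! ### Covariance of independent episodes -/

namespace Interaction

variable {dx dφ : ℕ} {U : Type*} [MeasurableSpace U] {S : NonlinearSystem dx dφ U}
  {A : Matrix (Fin dx) (Fin dφ) ℝ} {T H : ℕ} {Ω : Type*} [mΩ : MeasurableSpace Ω] {P : Measure Ω}

/-- The contribution of an episode to an entry of the covariance matrix, as a function of the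
trajectory. -/
def episodeCovariance (S : NonlinearSystem dx dφ U) (i j : Fin dφ)
    (τ : (Fin (H + 1) → Vec dx) × (Fin H → U)) : ℝ :=
  ∑ h : Fin H, S.φ (τ.1 h.castSucc) (τ.2 h) i * S.φ (τ.1 h.castSucc) (τ.2 h) j

theorem measurable_episodeCovariance (S : NonlinearSystem dx dφ U) (i j : Fin dφ) :
    Measurable (episodeCovariance (H := H) S i j) := by
  have h1 : ∀ h : Fin H, Measurable fun τ : (Fin (H + 1) → Vec dx) × (Fin H → U) =>
      S.φ (τ.1 h.castSucc) (τ.2 h) := fun h => by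
    have hx : Measurable fun τ : (Fin (H + 1) → Vec dx) × (Fin H → U) => τ.1 h.castSucc :=
      (measurable_pi_apply h.castSucc).comp measurable_fst
    have hu : Measurable fun τ : (Fin (H + 1) → Vec dx) × (Fin H → U) => τ.2 h :=
      (measurable_pi_apply h).comp measurable_snd
    exact S.measurable_φ.comp (hx.prodMk hu)
  exact Finset.measurable_fun_sum _ fun h _ =>
    ((EuclideanSpace.proj (𝕜 := ℝ) i).measurable.comp (h1 h)).mul
      ((EuclideanSpace.proj (𝕜 := ℝ) j).measurable.comp (h1 h))

theorem covariance_apply_eq_sum_episode (I : Interaction S A T H P) (ω : Ω) (i j : Fin dφ) :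
    I.covariance ω i j = ∑ t, episodeCovariance S i j (I.episode t ω) :=
  I.covariance_apply ω i j

theorem abs_episodeCovariance_le {B : ℝ} (hB : ∀ x u, ‖S.φ x u‖ ≤ B) (i j : Fin dφ)
    (τ : (Fin (H + 1) → Vec dx) × (Fin H → U)) :
    |episodeCovariance S i j τ| ≤ H * B ^ 2 := by
  have hc : ∀ x u (k : Fin dφ), |S.φ x u k| ≤ B := fun x u k =>
    (PiLp.norm_apply_le (S.φ x u) k).trans (hB x u)
  refine (Finset.abs_sum_le_sum_abs _ _).trans ?_
  calc _ ≤ ∑ _h : Fin H, B ^ 2 := Finset.sum_le_sum fun h _ => by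
        rw [abs_mul, sq]
        exact mul_le_mul (hc _ _ _) (hc _ _ _) (abs_nonneg _)
            ((abs_nonneg _).trans (hc (τ.1 h.castSucc) (τ.2 h) i))
    _ = H * B ^ 2 := by simp

theorem measurable_episode_comp (I : Interaction S A T H P) (i j : Fin dφ) (t : Fin T) :
    Measurable fun ω => episodeCovariance S i j (I.episode t ω) :=
  Finset.measurable_fun_sum _ fun h _ =>
    (I.measurable_feature_apply t h i).mul (I.measurable_feature_apply t h j)

/-- Hoeffding's inequality for one entry of the covariance matrix. -/
theorem measure_le_abs_covariance_sub_le [IsProbabilityMeasure P] (I : Interaction S A T H P)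
    {B : ℝ} (hB : ∀ x u, ‖S.φ x u‖ ≤ B) (hind : iIndepFun I.episode P) (i j : Fin dφ)
    {ε : ℝ} (hε : 0 ≤ ε) :
    P {ω | ε ≤ |I.covariance ω i j - I.meanCovariance i j|} ≤
      ENNReal.ofReal (2 * Real.exp (-ε ^ 2 / (2 * (T * (H * B ^ 2) ^ 2)))) := by
  set X : Fin T → Ω → ℝ := fun t ω => episodeCovariance S i j (I.episode t ω) with hX
  have hXm : ∀ t, Measurable (X t) := I.measurable_episode_comp i j
  have hXb : ∀ t, ∀ᵐ ω ∂P, X t ω ∈ Set.Icc (-(H * B ^ 2)) (H * B ^ 2) := fun t =>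
    Filter.Eventually.of_forall fun ω => abs_le.mp (abs_episodeCovariance_le hB i j _)
  have hmean : I.meanCovariance i j = ∑ t, ∫ ω, X t ω ∂P := by
    simp only [meanCovariance, Matrix.of_apply, covariance_apply_eq_sum_episode]
    exact integral_finsetSum _ fun t _ => Integrable.of_mem_Icc _ _ (hXm t).aemeasurable (hXb t)
  have hdev : ∀ ω, I.covariance ω i j - I.meanCovariance i j =
      ∑ t, (X t ω - ∫ ω', X t ω' ∂P) := fun ω => by
    rw [hmean, covariance_apply_eq_sum_episode, Finset.sum_sub_distrib]
  have hsub : ∀ t, HasSubgaussianMGF (fun ω => X t ω - ∫ ω', X t ω' ∂P)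
      ((‖(H * B ^ 2 : ℝ) - -(H * B ^ 2)‖₊ / 2) ^ 2) P := fun t =>
    hasSubgaussianMGF_of_mem_Icc (hXm t).aemeasurable (hXb t)
  have hiid : iIndepFun (fun t ω => X t ω - ∫ ω', X t ω' ∂P) P :=
    hind.comp (fun t τ => episodeCovariance S i j τ - ∫ ω', X t ω' ∂P)
      fun t => (measurable_episodeCovariance S i j).sub_const _
  have hiid' : iIndepFun (fun t => -(fun ω => X t ω - ∫ ω', X t ω' ∂P)) P :=
    hind.comp (fun t τ => -(episodeCovariance S i j τ - ∫ ω', X t ω' ∂P))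
      fun t => ((measurable_episodeCovariance S i j).sub_const _).neg
  have hc : (((‖(H * B ^ 2 : ℝ) - -(H * B ^ 2)‖₊ / 2) ^ 2 : NNReal) : ℝ) = (H * B ^ 2) ^ 2 := by
    push_cast
    rw [sub_neg_eq_add, ← two_mul, norm_mul, Real.norm_eq_abs, Real.norm_eq_abs,
      abs_of_nonneg (show (0 : ℝ) ≤ H * B ^ 2 by positivity)]
    norm_num
  have hv : (((∑ _t : Fin T, (‖(H * B ^ 2 : ℝ) - -(H * B ^ 2)‖₊ / 2) ^ 2 : NNReal)) : ℝ) =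
      T * (H * B ^ 2) ^ 2 := by
    rw [NNReal.coe_sum, Finset.sum_congr rfl fun _ _ => hc]
    simp
  have h1 := HasSubgaussianMGF.measure_sum_ge_le_of_iIndepFun hiid (s := Finset.univ)
    (fun t _ => hsub t) hε
  have h2 := HasSubgaussianMGF.measure_sum_ge_le_of_iIndepFun hiid' (s := Finset.univ)
    (fun t _ => (hsub t).neg) hε
  rw [hv] at h1 h2
  have hincl : {ω | ε ≤ |I.covariance ω i j - I.meanCovariance i j|} ⊆
      {ω | ε ≤ ∑ t, (X t ω - ∫ ω', X t ω' ∂P)} ∪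
        {ω | ε ≤ ∑ t, (-(fun ω => X t ω - ∫ ω', X t ω' ∂P)) ω} := by
    intro ω hω
    rcases le_abs.mp (show ε ≤ |I.covariance ω i j - I.meanCovariance i j| from hω) with h | h
    · left
      rw [hdev] at h
      exact h
    · right
      rw [hdev, ← Finset.sum_neg_distrib] at h
      exact h
  refine (measure_mono hincl).trans ((measure_union_le _ _).trans ?_)
  rw [← ofReal_measureReal, ← ofReal_measureReal,
    ← ENNReal.ofReal_add measureReal_nonneg measureReal_nonneg]
  exact ENNReal.ofReal_le_ofReal (by linarith)

end Interaction

/-- The form of a symmetric matrix with entries at most `ε` is bounded by `n ε |v|²`. -/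
theorem abs_dotProduct_mulVec_le_of_entries {n : ℕ} {E : Matrix (Fin n) (Fin n) ℝ} {ε : ℝ}
    (hE : ∀ i j, |E i j| ≤ ε) (v : Fin n → ℝ) :
    |v ⬝ᵥ E *ᵥ v| ≤ n * ε * (v ⬝ᵥ v) := by
  rcases Nat.eq_zero_or_pos n with rfl | hn
  · simp
  have hε : 0 ≤ ε := (abs_nonneg _).trans (hE ⟨0, hn⟩ ⟨0, hn⟩)
  have h1 : |v ⬝ᵥ E *ᵥ v| ≤ ε * (∑ i, |v i|) ^ 2 := by
    simp only [dotProduct, Matrix.mulVec, Finset.mul_sum]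
    refine (Finset.abs_sum_le_sum_abs _ _).trans ?_
    rw [sq, Finset.sum_mul_sum, Finset.mul_sum]
    refine Finset.sum_le_sum fun i _ => (Finset.abs_sum_le_sum_abs _ _).trans ?_
    rw [Finset.mul_sum]
    refine Finset.sum_le_sum fun j _ => ?_
    rw [abs_mul, abs_mul]
    have := mul_le_mul_of_nonneg_right (hE i j) (mul_nonneg (abs_nonneg (v i)) (abs_nonneg (v j)))
    linarith
  have h2 : (∑ i, |v i|) ^ 2 ≤ n * (v ⬝ᵥ v) := by
    have := sq_sum_le_card_mul_sum_sq (s := Finset.univ) (f := fun i => |v i|)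
    simpa [dotProduct_self_eq_sum_sq] using this
  calc _ ≤ ε * (n * (v ⬝ᵥ v)) := h1.trans (mul_le_mul_of_nonneg_left h2 hε)
    _ = _ := by ring

/-! ### Bounds on the model-task error -/

theorem Matrix.PosSemidef.trace_mul_inv_nonneg {ι : Type*} [Fintype ι] [DecidableEq ι]
    [Nonempty ι] {M Λ : Matrix ι ι ℝ} (hM : M.PosSemidef) (hΛ : Λ.PosDef) :
    0 ≤ (M * Λ⁻¹).trace := by
  set v : ι → ℝ := Pi.single (Classical.arbitrary ι) 1
  have hv : v ≠ 0 := by simp [v]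
  have h1 : 0 ≤ v ⬝ᵥ M *ᵥ v := by simpa using hM.dotProduct_mulVec_nonneg v
  have h2 : 0 < v ⬝ᵥ Λ *ᵥ v := by simpa using hΛ.dotProduct_mulVec_pos hv
  exact nonneg_of_mul_nonneg_left (h1.trans (hM.dotProduct_mulVec_le_trace_mul hΛ v)) h2

theorem mahalanobisNorm_vecMat_sub_sq {dx dφ : ℕ}
    {M : Matrix (Fin dx × Fin dφ) (Fin dx × Fin dφ) ℝ} (hM : M.PosSemidef)
    (A A' : Matrix (Fin dx) (Fin dφ) ℝ) :
    mahalanobisNorm M (vecMat (A - A')) ^ 2 =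
      (vecMat (A' - A)).ofLp ⬝ᵥ M *ᵥ (vecMat (A' - A)).ofLp := by
  have hneg : (vecMat (A - A')).ofLp = -(vecMat (A' - A)).ofLp := by
    ext p; simp [vecMat]
  rw [mahalanobisNorm, Real.sq_sqrt (by simpa using hM.dotProduct_mulVec_nonneg _), hneg,
    Matrix.mulVec_neg, neg_dotProduct_neg]

namespace Interaction

variable {dx dφ : ℕ} {U : Type*} [MeasurableSpace U] {S : NonlinearSystem dx dφ U}
  {A : Matrix (Fin dx) (Fin dφ) ℝ} {T H : ℕ} {Ω : Type*} [mΩ : MeasurableSpace Ω] {P : Measure Ω}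

theorem blockCovariance_sub_smul (I : Interaction S A T H P) (ω : Ω) (c : ℝ)
    (G : Matrix (Fin dφ) (Fin dφ) ℝ) :
    I.blockCovariance ω - c • ((1 : Matrix (Fin dx) (Fin dx) ℝ) ⊗ₖ G) =
      (1 : Matrix (Fin dx) (Fin dx) ℝ) ⊗ₖ (I.covariance ω - c • G) := by
  ext p q
  simp only [blockCovariance, Matrix.sub_apply, Matrix.smul_apply, Matrix.kroneckerMap_apply,
    smul_eq_mul]
  ring

theorem dotProduct_blockCovariance_mulVec_le (I : Interaction S A T H P) {B : ℝ}
    (hB : ∀ x u, ‖S.φ x u‖ ≤ B) (ω : Ω) (a : Fin dx × Fin dφ → ℝ) :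
    a ⬝ᵥ I.blockCovariance ω *ᵥ a ≤ T * H * B ^ 2 * (a ⬝ᵥ a) := by
  rw [I.dotProduct_blockCovariance_mulVec]
  have h1 : ∀ t h, inner ℝ (I.directedFeature a t h ω) (I.directedFeature a t h ω) ≤
      B ^ 2 * (a ⬝ᵥ a) := by
    intro t h
    have hφ : ∑ j, I.feature t h ω j ^ 2 ≤ B ^ 2 := by
      rw [← EuclideanSpace.real_norm_sq_eq]
      exact pow_le_pow_left₀ (norm_nonneg _) (hB _ _) 2
    rw [real_inner_self_eq_norm_sq, EuclideanSpace.real_norm_sq_eq, dotProduct_self_eq_sum_sq,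
      Fintype.sum_prod_type, Finset.mul_sum]
    refine Finset.sum_le_sum fun i _ => ?_
    refine (Finset.sum_mul_sq_le_sq_mul_sq Finset.univ (fun j => a (i, j))
      fun j => I.feature t h ω j).trans ?_
    rw [mul_comm (B ^ 2)]
    exact mul_le_mul_of_nonneg_left hφ (Finset.sum_nonneg fun j _ => sq_nonneg _)
  calc _ ≤ ∑ _t : Fin T, ∑ _h : Fin H, B ^ 2 * (a ⬝ᵥ a) :=
        Finset.sum_le_sum fun t _ => Finset.sum_le_sum fun h _ => h1 t h
    _ = _ := by simp; ring

/-- Any adaptive exploration: Cauchy–Schwarz reduces the error in the norm of `M` to the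
self-normalized error `e · Λ e`. -/
theorem measure_error_adaptive [IsProbabilityMeasure P] (I : Interaction S A T H P)
    (hdx : 1 ≤ dx) (hdφ : 1 ≤ dφ) {B : ℝ} (hB : ∀ x u, ‖S.φ x u‖ ≤ B)
    {Ahat : Ω → Matrix (Fin dx) (Fin dφ) ℝ} (hA : I.IsLeastSquares Ahat)
    {M : Matrix (Fin dx × Fin dφ) (Fin dx × Fin dφ) ℝ} (hM : M.PosSemidef)
    {δ : ℝ} (hδ : 0 < δ) (hδ1 : δ < 1) {C : ℝ} (hC : 12 ≤ C) :
    P {ω | ∃ lam : ℝ, 0 < lam ∧ (I.covariance ω - lam • 1).PosSemidef ∧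
        ¬ mahalanobisNorm M (vecMat (A - Ahat ω)) ^ 2 ≤
          C * (Real.log (1 / δ) + dx * dφ * Real.log (2 + T * H * B ^ 2 / lam)) * S.σ ^ 2 *
            (M * (I.blockCovariance ω)⁻¹).trace} ≤ ENNReal.ofReal δ := by
  have : Nonempty (Fin dx × Fin dφ) := ⟨(⟨0, hdx⟩, ⟨0, hdφ⟩)⟩
  refine (measure_mono ?_).trans (measure_selfNormalized_stitched (pow_pos S.σ_pos 2)
    I.measurable_score_apply I.measurable_blockCovariance_apply I.isSymm_blockCovariance
    I.lintegral_exp_score_le_one (I.dotProduct_blockCovariance_mulVec_le hB) hδ hδ1)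
  rintro ω ⟨lam, hlam, hpsd, hnot⟩
  set e := (vecMat (Ahat ω - A)).ofLp with he
  have hblock : (I.blockCovariance ω - lam • 1).PosSemidef := by
    rw [← Matrix.one_kronecker_one, blockCovariance_sub_smul]
    exact Matrix.PosSemidef.one.kronecker hpsd
  have hPD : (I.blockCovariance ω).PosDef := by
    have h : (lam • (1 : Matrix (Fin dx × Fin dφ) (Fin dx × Fin dφ) ℝ)).PosDef :=
      Matrix.PosDef.one.smul hlam
    simpa using h.add_posSemidef hblock
  refine ⟨lam, e, hlam, fun a => ?_, I.blockCovariance_mulVec_of_isLeastSquares hA ω, ?_⟩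
  · have := hblock.dotProduct_mulVec_nonneg a
    simp only [star_trivial, Matrix.sub_mulVec, Matrix.smul_mulVec, Matrix.one_mulVec,
      dotProduct_sub, dotProduct_smul, smul_eq_mul] at this
    linarith
  · by_contra hle
    push Not at hle
    refine hnot ?_
    rw [mahalanobisNorm_vecMat_sub_sq hM]
    have htr := hM.trace_mul_inv_nonneg hPD
    have hlog : 0 ≤ Real.log (1 / δ) + dx * dφ * Real.log (2 + T * H * B ^ 2 / lam) := by
      have h1 : 0 ≤ Real.log (1 / δ) := Real.log_nonneg (by rw [le_div_iff₀ hδ]; linarith)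
      have h2 : 0 ≤ T * H * B ^ 2 / lam := by positivity
      have h3 : 0 ≤ Real.log (2 + T * H * B ^ 2 / lam) := Real.log_nonneg (by linarith)
      positivity
    simp only [Fintype.card_prod, Fintype.card_fin, Nat.cast_mul] at hle
    calc e ⬝ᵥ M *ᵥ e ≤ (M * (I.blockCovariance ω)⁻¹).trace * (e ⬝ᵥ I.blockCovariance ω *ᵥ e) :=
          hM.dotProduct_mulVec_le_trace_mul hPD e
      _ ≤ (M * (I.blockCovariance ω)⁻¹).trace * (12 * S.σ ^ 2 *
          (Real.log (1 / δ) + dx * dφ * Real.log (2 + T * H * B ^ 2 / lam))) :=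
          mul_le_mul_of_nonneg_left hle htr
      _ = 12 * ((Real.log (1 / δ) + dx * dφ * Real.log (2 + T * H * B ^ 2 / lam)) * S.σ ^ 2 *
          (M * (I.blockCovariance ω)⁻¹).trace) := by ring
      _ ≤ C * ((Real.log (1 / δ) + dx * dφ * Real.log (2 + T * H * B ^ 2 / lam)) * S.σ ^ 2 *
          (M * (I.blockCovariance ω)⁻¹).trace) :=
          mul_le_mul_of_nonneg_right hC (by positivity)
      _ = _ := by ring

/-- The weighted error bound around `Γ`, with the normal equations inserted. The hypothesis `hK`
lets the dimensional factor be absorbed into a constant. -/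
theorem measure_error_near [IsProbabilityMeasure P] (I : Interaction S A T H P)
    (hdx : 1 ≤ dx) (hdφ : 1 ≤ dφ)
    {Ahat : Ω → Matrix (Fin dx) (Fin dφ) ℝ} (hA : I.IsLeastSquares Ahat)
    {M Γ : Matrix (Fin dx × Fin dφ) (Fin dx × Fin dφ) ℝ} (hM : M.PosSemidef) (hΓ : Γ.PosDef)
    {β δ : ℝ} (hβ : β ≤ 1 / 4) (hδ : 0 < δ) (hδ1 : δ < 1) {K : ℝ}
    (hK : 15 * (1 + β ^ 2 * (dx * dφ)) * Real.log (2 * (dx * dφ) / δ) ≤ K) :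
    P {ω | (I.blockCovariance ω - (1 - β) • Γ).PosSemidef ∧
        ((1 + β) • Γ - I.blockCovariance ω).PosSemidef ∧
        ¬ mahalanobisNorm M (vecMat (A - Ahat ω)) ^ 2 ≤
          K * S.σ ^ 2 * (M * (I.blockCovariance ω)⁻¹).trace} ≤ ENNReal.ofReal δ := by
  have : Nonempty (Fin dx × Fin dφ) := ⟨(⟨0, hdx⟩, ⟨0, hdφ⟩)⟩
  refine (measure_mono ?_).trans (measure_weighted_error_near (pow_pos S.σ_pos 2)
    I.measurable_score_apply I.measurable_blockCovariance_apply
    I.lintegral_exp_score_le_one hM hΓ hβ hδ hδ1)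
  rintro ω ⟨h1, h2, hnot⟩
  have hPD : (I.blockCovariance ω).PosDef := by
    have h : ((1 - β) • Γ).PosDef := hΓ.smul (by linarith)
    simpa using h.add_posSemidef h1
  refine ⟨h1, h2, _, I.blockCovariance_mulVec_of_isLeastSquares hA ω, ?_⟩
  rw [mahalanobisNorm_vecMat_sub_sq hM, not_le] at hnot
  refine lt_of_le_of_lt ?_ hnot
  simp only [Fintype.card_prod, Fintype.card_fin, Nat.cast_mul]
  have htr := hM.trace_mul_inv_nonneg hPD
  gcongr

/-- With `β = 1 / (4 √(dx dφ))`, entries of the covariance within `β lam T / dφ` of their means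
put the matrix within `(1 ± β)` of its mean. -/
theorem measure_not_near_meanCovariance [IsProbabilityMeasure P] (I : Interaction S A T H P)
    (hdx : 1 ≤ dx) (hdφ : 1 ≤ dφ) (hH : 1 ≤ H) (hT : 1 ≤ T)
    {B : ℝ} (hB : ∀ x u, ‖S.φ x u‖ ≤ B) (hind : iIndepFun I.episode P)
    {lam : ℝ} (hlam : 0 < lam) (hmean : (I.meanCovariance - (lam * T) • 1).PosSemidef)
    {δ : ℝ} (hδ : 0 < δ) (hδ1 : δ < 1)
    (hTl : 64 * (dx * dφ ^ 3 * H ^ 2 * B ^ 4 / lam ^ 2) * Real.log (6 * dx * dφ / δ) ≤ T) :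
    P {ω | ¬ ((I.covariance ω - (1 - 1 / (4 * Real.sqrt (dx * dφ))) • I.meanCovariance).PosSemidef ∧
        ((1 + 1 / (4 * Real.sqrt (dx * dφ))) • I.meanCovariance - I.covariance ω).PosSemidef)} ≤
      ENNReal.ofReal (δ / 2) := by
  have hdx' : (1 : ℝ) ≤ dx := by exact_mod_cast hdx
  have hdφ' : (1 : ℝ) ≤ dφ := by exact_mod_cast hdφ
  have hH' : (1 : ℝ) ≤ H := by exact_mod_cast hH
  have hT' : (1 : ℝ) ≤ T := by exact_mod_cast hT
  have hd : 0 < (dx * dφ : ℝ) := by positivity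
  set r := Real.sqrt (dx * dφ) with hr
  have hr0 : 0 < r := Real.sqrt_pos.mpr hd
  have hr2 : r ^ 2 = dx * dφ := Real.sq_sqrt hd.le
  set ε : ℝ := lam * T / (4 * r * dφ) with hε
  have hε0 : 0 < ε := by positivity
  set E : Fin dφ × Fin dφ → Set Ω := fun k =>
    {ω | ε ≤ |I.covariance ω k.1 k.2 - I.meanCovariance k.1 k.2|} with hE
  -- otherwise the features vanish and the mean cannot be positive definite
  have hB0 : 0 < (B ^ 2) := by
    by_contra h0
    have hB00 : B = 0 := by
      have : B ^ 2 = 0 := le_antisymm (not_lt.mp h0) (sq_nonneg B)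
      simpa using this
    have hz : ∀ i j, I.meanCovariance i j = 0 := fun i j => by
      have : ∀ ω, I.covariance ω i j = 0 := fun ω => by
        rw [I.covariance_apply_eq_sum_episode]
        refine Finset.sum_eq_zero fun t _ => ?_
        have := abs_episodeCovariance_le (H := H) hB i j (I.episode t ω)
        rw [hB00] at this
        simpa using this
      simp [meanCovariance, this]
    have := hmean.diag_nonneg (i := ⟨0, hdφ⟩)
    simp [hz] at this
    have : 0 < lam * T := by positivity
    linarith
  have hexp : 2 * Real.exp (-ε ^ 2 / (2 * (T * (H * B ^ 2) ^ 2))) ≤ δ / (2 * dφ ^ 2) := by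
    have hx : 2 * Real.log (6 * dx * dφ / δ) ≤ ε ^ 2 / (2 * (T * (H * B ^ 2) ^ 2)) := by
      have e1 : ε ^ 2 = lam ^ 2 * T ^ 2 / (16 * (dx * dφ) * dφ ^ 2) := by
        rw [hε, div_pow, mul_pow, mul_pow, mul_pow, hr2]; norm_num
      rw [e1, le_div_iff₀ (by positivity), le_div_iff₀ (by positivity)]
      have h := mul_le_mul_of_nonneg_right hTl (show 0 ≤ lam ^ 2 * T by positivity)
      have e2 : 64 * (dx * dφ ^ 3 * H ^ 2 * B ^ 4 / lam ^ 2) * Real.log (6 * dx * dφ / δ) *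
          (lam ^ 2 * T) = 64 * (dx * dφ ^ 3 * H ^ 2 * B ^ 4) * Real.log (6 * dx * dφ / δ) * T := by
        field_simp
      rw [e2] at h
      linarith
    -- the union bound over entries and signs needs `log (4 dφ² / δ)`
    have hy : (4 * dφ ^ 2 / δ : ℝ) ≤ (6 * dx * dφ / δ) ^ 2 := by
      rw [div_pow, div_le_div_iff₀ hδ (by positivity)]
      have h1 : (4 * dφ ^ 2 : ℝ) ≤ (6 * dx * dφ) ^ 2 := by
        rw [mul_pow]
        have : (4 : ℝ) ≤ (6 * dx) ^ 2 := by nlinarith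
        gcongr
      have h2 : δ ^ 2 ≤ δ := by nlinarith
      gcongr
    have hlog : Real.log (4 * dφ ^ 2 / δ) ≤ ε ^ 2 / (2 * (T * (H * B ^ 2) ^ 2)) := by
      refine (Real.log_le_log (by positivity) hy).trans ?_
      rw [Real.log_pow]
      exact_mod_cast hx
    rw [neg_div, Real.exp_neg]
    have h3 : (4 * dφ ^ 2 / δ : ℝ) ≤ Real.exp (ε ^ 2 / (2 * (T * (H * B ^ 2) ^ 2))) := by
      rw [← Real.exp_log (show (0 : ℝ) < 4 * dφ ^ 2 / δ by positivity)]
      exact Real.exp_le_exp.mpr hlog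
    calc _ ≤ 2 * (4 * dφ ^ 2 / δ : ℝ)⁻¹ := by gcongr
      _ = _ := by field_simp; norm_num
  have htot : P (⋃ k, E k) ≤ ENNReal.ofReal (δ / 2) := by
    refine (measure_iUnion_fintype_le P E).trans ((Finset.sum_le_sum fun k _ =>
      (I.measure_le_abs_covariance_sub_le hB hind k.1 k.2 hε0.le).trans
        (ENNReal.ofReal_le_ofReal hexp)).trans ?_)
    rw [Finset.sum_const, nsmul_eq_mul, Finset.card_univ, Fintype.card_prod, Fintype.card_fin,
      ← ENNReal.ofReal_natCast, ← ENNReal.ofReal_mul (by positivity)]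
    refine ENNReal.ofReal_le_ofReal (le_of_eq ?_)
    push_cast
    field_simp
  refine (measure_mono fun ω hω => ?_).trans htot
  by_contra hnot
  simp only [Set.mem_iUnion, not_exists] at hnot
  refine hω ?_
  have hentry : ∀ i j, |(I.covariance ω - I.meanCovariance) i j| ≤ ε := fun i j =>
    (not_le.mp (hnot (i, j))).le
  have hmsymm : I.meanCovariance.IsHermitian := by
    have h := hmean.isHermitian
    simpa using h.add (Matrix.isHermitian_one.smul (k := lam * (T : ℝ)) (by simp [IsSelfAdjoint]))
  have hcsymm : (I.covariance ω).IsHermitian := by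
    ext i j
    simp only [Matrix.conjTranspose_apply, star_trivial, I.covariance_apply,
      mul_comm (I.feature _ _ ω j)]
  have hquad : ∀ v : Fin dφ → ℝ, |v ⬝ᵥ I.covariance ω *ᵥ v - v ⬝ᵥ I.meanCovariance *ᵥ v| ≤
      1 / (4 * r) * (v ⬝ᵥ I.meanCovariance *ᵥ v) := by
    intro v
    have h1 := abs_dotProduct_mulVec_le_of_entries hentry v
    rw [Matrix.sub_mulVec, dotProduct_sub] at h1
    have h2 := hmean.dotProduct_mulVec_nonneg v
    simp only [star_trivial, Matrix.sub_mulVec, Matrix.smul_mulVec, Matrix.one_mulVec,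
      dotProduct_sub, dotProduct_smul, smul_eq_mul] at h2
    refine h1.trans ?_
    calc dφ * ε * (v ⬝ᵥ v) = 1 / (4 * r) * (lam * T * (v ⬝ᵥ v)) := by rw [hε]; field_simp
      _ ≤ _ := mul_le_mul_of_nonneg_left (by linarith) (by positivity)
  constructor
  · refine Matrix.PosSemidef.of_dotProduct_mulVec_nonneg
      (hcsymm.sub (hmsymm.smul (by simp [IsSelfAdjoint]))) fun v => ?_
    have := (abs_le.mp (hquad v)).1
    simp only [star_trivial, Matrix.sub_mulVec, Matrix.smul_mulVec, dotProduct_sub,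
      dotProduct_smul, smul_eq_mul]
    linarith
  · refine Matrix.PosSemidef.of_dotProduct_mulVec_nonneg
      ((hmsymm.smul (by simp [IsSelfAdjoint])).sub hcsymm) fun v => ?_
    have := (abs_le.mp (hquad v)).2
    simp only [star_trivial, Matrix.sub_mulVec, Matrix.smul_mulVec, dotProduct_sub,
      dotProduct_smul, smul_eq_mul]
    linarith

/-- Half of `δ` pays for the covariance estimate and half for the error bound around
`Γ = 1 ⊗ 𝔼 Λ_T`; as `β² dx dφ = 1 / 16`, the latter has no dimensional factor. -/
theorem measure_error_independent [IsProbabilityMeasure P] (I : Interaction S A T H P)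
    (hdx : 1 ≤ dx) (hdφ : 1 ≤ dφ) (hH : 1 ≤ H) (hT : 1 ≤ T)
    {B : ℝ} (hB : ∀ x u, ‖S.φ x u‖ ≤ B)
    {Ahat : Ω → Matrix (Fin dx) (Fin dφ) ℝ} (hA : I.IsLeastSquares Ahat)
    {M : Matrix (Fin dx × Fin dφ) (Fin dx × Fin dφ) ℝ} (hM : M.PosSemidef)
    (hind : iIndepFun I.episode P) {lam : ℝ} (hlam : 0 < lam)
    (hmean : (I.meanCovariance - (lam * T) • 1).PosSemidef) {δ : ℝ} (hδ : 0 < δ) (hδ1 : δ < 1)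
    (hTl : 64 * (dx * dφ ^ 3 * H ^ 2 * B ^ 4 / lam ^ 2) * Real.log (6 * dx * dφ / δ) ≤ T) :
    P {ω | ¬ ((I.covariance ω).PosDef ∧ mahalanobisNorm M (vecMat (A - Ahat ω)) ^ 2 ≤
        64 * Real.log (6 * dx * dφ / δ) * S.σ ^ 2 * (M * (I.blockCovariance ω)⁻¹).trace)} ≤
      ENNReal.ofReal δ := by
  have hdx' : (1 : ℝ) ≤ dx := by exact_mod_cast hdx
  have hdφ' : (1 : ℝ) ≤ dφ := by exact_mod_cast hdφ
  have hT' : (1 : ℝ) ≤ T := by exact_mod_cast hT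
  have hd : 1 ≤ (dx * dφ : ℝ) := one_le_mul_of_one_le_of_one_le hdx' hdφ'
  set β : ℝ := 1 / (4 * Real.sqrt (dx * dφ)) with hβ
  have hβ4 : β ≤ 1 / 4 := by
    have : 1 ≤ Real.sqrt (dx * dφ) := Real.one_le_sqrt.mpr hd
    exact one_div_le_one_div_of_le (by norm_num) (by linarith)
  have hβ2 : β ^ 2 * (dx * dφ) = 1 / 16 := by
    rw [hβ, div_pow, mul_pow, Real.sq_sqrt (by linarith)]
    field_simp
    norm_num
  have hmPD : I.meanCovariance.PosDef := by
    have h : ((lam * T) • (1 : Matrix (Fin dφ) (Fin dφ) ℝ)).PosDef :=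
      Matrix.PosDef.one.smul (by positivity)
    simpa using h.add_posSemidef hmean
  have hΓ : ((1 : Matrix (Fin dx) (Fin dx) ℝ) ⊗ₖ I.meanCovariance).PosDef :=
    Matrix.PosDef.one.kronecker hmPD
  have hL : 0 ≤ Real.log (6 * dx * dφ / δ) :=
    Real.log_nonneg (by rw [le_div_iff₀ hδ]; nlinarith)
  have hK : 15 * (1 + β ^ 2 * (dx * dφ)) * Real.log (2 * (dx * dφ) / (δ / 2)) ≤
      64 * Real.log (6 * dx * dφ / δ) := by
    rw [hβ2]
    have : Real.log (2 * (dx * dφ) / (δ / 2)) ≤ Real.log (6 * dx * dφ / δ) := by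
      refine Real.log_le_log (by positivity) ?_
      rw [div_le_div_iff₀ (by positivity) hδ]
      nlinarith
    linarith
  have h1 := I.measure_not_near_meanCovariance hdx hdφ hH hT hB hind hlam hmean hδ hδ1 hTl
  have h2 := I.measure_error_near hdx hdφ hA hM hΓ hβ4 (half_pos hδ) (by linarith) hK
  rw [← hβ] at h1
  have hsum : ENNReal.ofReal (δ / 2) + ENNReal.ofReal (δ / 2) = ENNReal.ofReal δ := by
    rw [← ENNReal.ofReal_add (by positivity) (by positivity), add_halves]
  refine (measure_mono ?_).trans ((measure_union_le _ _).trans ((add_le_add h1 h2).trans hsum.le))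
  intro ω hω
  by_contra hnot
  simp only [Set.mem_union, not_or] at hnot
  obtain ⟨hn1, hn2⟩ := hnot
  have hnear := not_not.mp hn1
  have hup : ((1 + β) • ((1 : Matrix (Fin dx) (Fin dx) ℝ) ⊗ₖ I.meanCovariance) -
      I.blockCovariance ω).PosSemidef := by
    have : (1 + β) • ((1 : Matrix (Fin dx) (Fin dx) ℝ) ⊗ₖ I.meanCovariance) -
        I.blockCovariance ω = (1 : Matrix (Fin dx) (Fin dx) ℝ) ⊗ₖ
          ((1 + β) • I.meanCovariance - I.covariance ω) := by
      rw [← neg_sub, I.blockCovariance_sub_smul, ← neg_sub (I.covariance ω)]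
      ext p q
      simp
      ring
    rw [this]
    exact Matrix.PosSemidef.one.kronecker hnear.2
  have hlow : (I.blockCovariance ω -
      (1 - β) • ((1 : Matrix (Fin dx) (Fin dx) ℝ) ⊗ₖ I.meanCovariance)).PosSemidef := by
    rw [I.blockCovariance_sub_smul]
    exact Matrix.PosSemidef.one.kronecker hnear.1
  refine hω ⟨?_, ?_⟩
  · have h : ((1 - β) • I.meanCovariance).PosDef := hmPD.smul (by linarith)
    simpa using h.add_posSemidef hnear.1
  · by_contra hbad
    exact hn2 ⟨hlow, hup, hbad⟩

end Interaction

theorem mainTheorem5 :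
    ∃ C : ℝ, 0 < C ∧
      ∀ (dx dφ dθ H T : ℕ), 1 ≤ dx → 1 ≤ dφ → 1 ≤ H → 1 ≤ T →
      ∀ (U : Type*) [MeasurableSpace U] (S : NonlinearSystem dx dφ U)
        (Astar : Matrix (Fin dx) (Fin dφ) ℝ)
        (B : ℝ), (∀ x u, ‖S.φ x u‖ ≤ B) →
      ∀ (K : ControlTask dx dθ U) (r L : ℝ), 0 < r → K.BoundedCost S H Astar r L →
      ∀ (θstar : Matrix (Fin dx) (Fin dφ) ℝ → Vec dθ),
        K.IsOptimalNear S H Astar r θstar →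
        TwiceDifferentiableAt (K.ceCost S H Astar θstar) (vecMat Astar) →
      ∀ (Ω : Type*) [MeasurableSpace Ω] (P : Measure Ω) [IsProbabilityMeasure P]
        (I : Interaction S Astar T H P) (Ahat : Ω → Matrix (Fin dx) (Fin dφ) ℝ),
        I.IsLeastSquares Ahat →
      ∀ δ : ℝ, 0 < δ → δ < 1 →
      -- arbitrary adaptive exploration
      (P {ω | ∃ lam : ℝ, 0 < lam ∧ (I.covariance ω - lam • 1).PosSemidef ∧
          ¬ mahalanobisNorm (K.modelTaskHessian S H Astar θstar) (vecMat (Astar - Ahat ω)) ^ 2 ≤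
            C * (Real.log (1 / δ) + dx * dφ * Real.log (2 + T * H * B ^ 2 / lam)) * S.σ ^ 2 *
              (K.modelTaskHessian S H Astar θstar * (I.blockCovariance ω)⁻¹).trace}
        ≤ ENNReal.ofReal δ) ∧
      -- adaptive exploration, observed covariance close to a deterministic matrix
      (∀ (Γ : Matrix (Fin dx × Fin dφ) (Fin dx × Fin dφ) ℝ) (β : ℝ), Γ.PosDef →
        0 ≤ β → β ≤ 1 / 4 →
        P {ω | (I.blockCovariance ω - (1 - β) • Γ).PosSemidef ∧
            ((1 + β) • Γ - I.blockCovariance ω).PosSemidef ∧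
            ¬ mahalanobisNorm (K.modelTaskHessian S H Astar θstar) (vecMat (Astar - Ahat ω)) ^ 2 ≤
              C * (1 + β ^ 2 * (dx * dφ)) * Real.log (6 * dx * dφ / δ) * S.σ ^ 2 *
                (K.modelTaskHessian S H Astar θstar * (I.blockCovariance ω)⁻¹).trace}
          ≤ ENNReal.ofReal δ) ∧
      -- episodes explored independently
      (∀ lam : ℝ, 0 < lam → iIndepFun I.episode P →
        (I.meanCovariance - (lam * T) • 1).PosSemidef →
        C * (dx * dφ ^ 3 * H ^ 2 * B ^ 4 / lam ^ 2) * Real.log (6 * dx * dφ / δ) ≤ T →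
        P {ω | ¬ ((I.covariance ω).PosDef ∧
            mahalanobisNorm (K.modelTaskHessian S H Astar θstar) (vecMat (Astar - Ahat ω)) ^ 2 ≤
              C * Real.log (6 * dx * dφ / δ) * S.σ ^ 2 *
                (K.modelTaskHessian S H Astar θstar * (I.blockCovariance ω)⁻¹).trace)}
          ≤ ENNReal.ofReal δ) := by
  -- `64` comes from the number of episodes Hoeffding's inequality asks for; the error bounds need
  -- only `12` and `15 * 17 / 16`
  refine ⟨64, by norm_num, ?_⟩
  intro dx dφ dθ H T hdx hdφ hH hT U _ S Astar B hB K r L hr _ θstar hopt hdiff Ω _ P _ I Ahat hA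
    δ hδ hδ1
  have hM := K.posSemidef_modelTaskHessian S Astar hr θstar hopt hdiff
  refine ⟨I.measure_error_adaptive hdx hdφ hB hA hM hδ hδ1 (by norm_num), ?_, ?_⟩
  · intro Γ β hΓ _ hβ
    refine I.measure_error_near hdx hdφ hA hM hΓ hβ hδ hδ1 ?_
    have hd : (0 : ℝ) < dx * dφ := by
      have h1 : (1 : ℝ) ≤ dx := by exact_mod_cast hdx
      have h2 : (1 : ℝ) ≤ dφ := by exact_mod_cast hdφ
      positivity
    have hlog : Real.log (2 * (dx * dφ) / δ) ≤ Real.log (6 * dx * dφ / δ) := by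
      refine Real.log_le_log (by positivity) ?_
      refine div_le_div_of_nonneg_right ?_ hδ.le
      linarith
    have hlog2 : 0 ≤ Real.log (2 * (dx * dφ) / δ) := by
      have h1 : (1 : ℝ) ≤ dx * dφ := by exact_mod_cast Nat.mul_pos hdx hdφ
      exact Real.log_nonneg (by rw [le_div_iff₀ hδ]; linarith)
    exact mul_le_mul (mul_le_mul_of_nonneg_right (by norm_num) (by positivity)) hlog
      hlog2 (by positivity)
  · intro lam hlam hind hmean hTl
    exact I.measure_error_independent hdx hdφ hH hT hB hA hM hind hlam hmean hδ hδ1 hTl
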